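/- Let $n\ge 1$, let $M'\subset\mathbb{C}^{n+1}$ be a real-analytic (embedded) real hypersurface, and let $q_0\in M'$. For $p\in M'$ choose a smooth local defining function $\rho$ of $M'$ near $p$ (with $d\rho\neq0$ along $M'$) and a basis $L_1,\dots,L_n$ of the CR vector fields (the vector fields $\sum_j a_j\,\partial/\partial\bar z_j$ tangent to $M'$) near $p$. Put $\rho_Z=(\partial\rho/\partial z_1,\dots,\partial\rho/\partial z_{n+1})$ and $$E_l(p)=\mathrm{Span}_{\mathbb{C}}\{\,L_1^{\alpha_1}\cdots L_n^{\alpha_n}\rho_Z(p)\;:\;\alpha_1+\dots+\alpha_n\le l\,\}\subset\mathbb{C}^{n+1},$$ which does not depend on the choices. $M'$ is finitely nondegenerate at $p$ if $E_{k-1}(p)\neq E_k(p)=\mathbb{C}^{n+1}$ for some integer $k\ge1$. $M'$ is holomorphically nondegenerate at $q_0$ if every germ at $q_0$ of a holomorphic vector field $\sum_j Y_j(Z)\,\partial/\partial z_j$ that is tangent to $M'$ (that is, $\sum_j Y_j\,\partial\rho/\partial z_j=0$ on $M'$) vanishes on $M'$ near $q_0$. Then there exist an open neighborhood $V$ of $q_0$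 in $\mathbb{C}^{n+1}$ and a complex analytic subvariety $X$ of $V$ (a subset of $V$ that near every point of $V$ is the set of common zeros of finitely many holomorphic functions) such that, for every $p\in M'\cap V$, $M'$ is finitely nondegenerate at $p$ if and only if $p\notin X$. Moreover, if $M'$ is holomorphically nondegenerate at $q_0$, then $X$ and $V$ can be chosen such that in addition $X$ has empty interior. -/

import Mathlib

open scoped Topology ContDiff

noncomputable section

/-- The Wirtinger derivative `∂f/∂z_j = (1/2) (∂f/∂x_j - i ∂f/∂y_j)` at `p`, where `z_j = x_j + i y_j`. -/
def wirtingerDeriv {N : ℕ} (j : Fin N) (f : (Fin N → ℂ) → ℂ) (p : Fin N → ℂ) : ℂ :=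
  (1 / 2 : ℂ) * (fderiv ℝ f p (Pi.single j 1) - Complex.I * fderiv ℝ f p (Pi.single j Complex.I))

/-- The conjugate Wirtinger derivative `∂f/∂z̄_j = (1/2) (∂f/∂x_j + i ∂f/∂y_j)` at `p`. -/
def wirtingerDerivBar {N : ℕ} (j : Fin N) (f : (Fin N → ℂ) → ℂ) (p : Fin N → ℂ) : ℂ :=
  (1 / 2 : ℂ) * (fderiv ℝ f p (Pi.single j 1) + Complex.I * fderiv ℝ f p (Pi.single j Complex.I))

/-- `ρ` is a smooth local defining function of the real hypersurface `M` of `ℂ^N` on the open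
set `U`. -/
structure IsDefiningFunction {N : ℕ} (M U : Set (Fin N → ℂ)) (ρ : (Fin N → ℂ) → ℝ) : Prop where
  isOpen : IsOpen U
  smooth : ContDiffOn ℝ ∞ ρ U
  zero_iff : ∀ x ∈ U, ρ x = 0 ↔ x ∈ M
  fderiv_ne_zero : ∀ x ∈ M ∩ U, fderiv ℝ ρ x ≠ 0

/-- `M` is a (locally closed, embedded) real-analytic real hypersurface of `ℂ^N`. -/
def IsRealAnalyticHypersurface {N : ℕ} (M : Set (Fin N → ℂ)) : Prop :=
  ∀ p ∈ M, ∃ (U : Set (Fin N → ℂ)) (ρ : (Fin N → ℂ) → ℝ),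
    p ∈ U ∧ IsDefiningFunction M U ρ ∧ AnalyticOnNhd ℝ ρ U

/-- The gradient component `∂ρ/∂z_j`, as a complex-valued function. -/
def holGradient {N : ℕ} (ρ : (Fin N → ℂ) → ℝ) (j : Fin N) (x : Fin N → ℂ) : ℂ :=
  wirtingerDeriv j (fun y => (ρ y : ℂ)) x

/-- The action of the `(0,1)` vector field `∑ j, a_j ∂/∂z̄_j` on a function. -/
def antiholApply {N : ℕ} (a : (Fin N → ℂ) → (Fin N → ℂ)) (f : (Fin N → ℂ) → ℂ) :
    (Fin N → ℂ) → ℂ :=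
  fun x => ∑ j, a x j * wirtingerDerivBar j f x

/-- `L_1, …, L_n` is a smooth basis of CR vector fields over `M ∩ U`, where `M` is the real
hypersurface of `ℂ^(n+1)` with defining function `ρ` on `U` (so `M` has CR dimension `n`). Here
`L_i = ∑ j, (L i)_j ∂/∂z̄_j`, its coefficients being extended smoothly to `U`; tangency to `M`
is `L_i ρ = 0` along `M`. -/
structure IsCRFrame {n : ℕ} (M U : Set (Fin (n + 1) → ℂ)) (ρ : (Fin (n + 1) → ℂ) → ℝ)
    (L : Fin n → (Fin (n + 1) → ℂ) → (Fin (n + 1) → ℂ)) : Prop where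
  smooth : ∀ i, ContDiffOn ℝ ∞ (L i) U
  tangent : ∀ i, ∀ x ∈ M ∩ U, antiholApply (L i) (fun y => (ρ y : ℂ)) x = 0
  linearIndependent : ∀ x ∈ M ∩ U, LinearIndependent ℂ (fun i => L i x)

/-- `L^α f = L_1^{α_1} ⋯ L_n^{α_n} f`. -/
def multiApply {n N : ℕ} (L : Fin n → (Fin N → ℂ) → (Fin N → ℂ)) (α : Fin n → ℕ)
    (f : (Fin N → ℂ) → ℂ) : (Fin N → ℂ) → ℂ :=
  (List.finRange n).foldr (fun i g => (antiholApply (L i))^[α i] g) f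

/-- `E_l(p)`, the complex span of the vectors `L^α ρ_Z (p)` with `|α| ≤ l`, where
`ρ_Z = (∂ρ/∂z_1, …, ∂ρ/∂z_N)`. -/
def nondegSpace {n N : ℕ} (ρ : (Fin N → ℂ) → ℝ) (L : Fin n → (Fin N → ℂ) → (Fin N → ℂ))
    (l : ℕ) (p : Fin N → ℂ) : Submodule ℂ (Fin N → ℂ) :=
  Submodule.span ℂ {v | ∃ α : Fin n → ℕ, ∑ i, α i ≤ l ∧
    v = fun j => multiApply L α (holGradient ρ j) p}

/-- The real hypersurface `M` of `ℂ^(n+1)` is `k`-nondegenerate at `p ∈ M`, `k ≥ 1`: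
`E_{k-1}(p) ≠ E_k(p) = ℂ^(n+1)` for a choice of a local defining function and of a basis of CR
vector fields near `p`. (The spaces `E_l(p)` do not depend on that choice.) -/
def IsKNondegenerateAt {n : ℕ} (M : Set (Fin (n + 1) → ℂ)) (k : ℕ) (p : Fin (n + 1) → ℂ) : Prop :=
  1 ≤ k ∧ p ∈ M ∧ ∃ (U : Set (Fin (n + 1) → ℂ)) (ρ : (Fin (n + 1) → ℂ) → ℝ)
    (L : Fin n → (Fin (n + 1) → ℂ) → (Fin (n + 1) → ℂ)),
    p ∈ U ∧ IsDefiningFunction M U ρ ∧ IsCRFrame M U ρ L ∧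
      nondegSpace ρ L (k - 1) p ≠ nondegSpace ρ L k p ∧ nondegSpace ρ L k p = ⊤

/-- `M` is finitely nondegenerate at `p`. -/
def IsFinitelyNondegenerateAt {n : ℕ} (M : Set (Fin (n + 1) → ℂ)) (p : Fin (n + 1) → ℂ) : Prop :=
  ∃ k, IsKNondegenerateAt M k p

/-- `M` is holomorphically nondegenerate at `p`: every holomorphic vector field
`Y = ∑ j, Y_j ∂/∂z_j` near `p` that is tangent to `M`, that is `Y ρ = 0` along `M`, vanishes on
`M` near `p`. -/
def IsHolomorphicallyNondegenerateAt {N : ℕ} (M : Set (Fin N → ℂ)) (p : Fin N → ℂ) : Prop :=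
  ∀ (W : Set (Fin N → ℂ)) (ρ : (Fin N → ℂ) → ℝ) (Y : (Fin N → ℂ) → (Fin N → ℂ)),
    p ∈ W → IsDefiningFunction M W ρ → DifferentiableOn ℂ Y W →
      (∀ x ∈ M ∩ W, ∑ j, Y x j * holGradient ρ j x = 0) → ∀ᶠ x in 𝓝[M] p, Y x = 0

/-- `X` is a complex analytic subvariety of the open set `V`: near every point of `V` it is the
set of common zeros of finitely many holomorphic functions. -/
def IsComplexAnalyticVariety {N : ℕ} (V X : Set (Fin N → ℂ)) : Prop :=
  X ⊆ V ∧ ∀ p ∈ V, ∃ W : Set (Fin N → ℂ), IsOpen W ∧ p ∈ W ∧ W ⊆ V ∧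
    ∃ (m : ℕ) (f : Fin m → (Fin N → ℂ) → ℂ), (∀ i, DifferentiableOn ℂ (f i) W) ∧
      ∀ x ∈ W, x ∈ X ↔ ∀ i, f i x = 0

end

/-! Complexify the defining function to a holomorphic `R (z, ζ)` with `R (x, star x) = ρ x`, and
parametrize the conjugated Segre variety `{ζ | R (z, ζ) = 0}` by `χ ↦ H (z, χ)`, holomorphically in
`z` as well (`SegreChart`). Put `phi z χ = ∂R/∂z (z, H (z, χ))`. On `M` the CR derivatives of `ρ_Z`
at `p` are the `χ`-derivatives of `phi p` at the conjugate of `p`. A holomorphic function of `χ`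
vanishes exactly when all its derivatives at one point do. Hence `M` is finitely nondegenerate at
`p` iff the vectors `phi p χ` span `ℂ^(n+1)` (`SegreChart.isFinitelyNondegenerateAt_iff`), and this
condition makes sense for `z` off `M`.

The set `X` is where every determinant of `n + 1` vectors `phi z χ` vanishes. These determinants are
an infinite family of functions of `z`, all holomorphic on one ball. That finitely many of them
define `X` near `q₀` is `hasFiniteZeroSubfamily_of_contDiffOn`, a Noetherian property of zero sets
proved by induction on the dimension. On the zero set of one member, Weierstrass division turns the
others into polynomials of bounded degree in one variable, and the induction hypothesis controls the
spans of their coefficient vectors. The division must hold on a neighbourhood common to all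
dividends, which inverting an operator on the disc algebra provides
(`exists_weierstrass_remainder`).

If `X` has interior points, all the determinants vanish identically on the ball. Cramer's rule then
gives a holomorphic `Y ≠ 0` annihilating every `phi z χ` (`exists_analytic_annihilator`). Taking `χ`
conjugate to a point of `M` shows that `Y` is tangent to `M`. Holomorphic nondegeneracy makes `Y`
vanish on `M` near `q₀`, hence identically (`eqOn_zero_of_eventually_zero_on_hypersurface`), a
contradiction. -/

open Metric

/-! ### The disc algebra and division by powers of the coordinate. -/

/-- The disc algebra: continuous functions on the closed disc of radius `δ` that are holomorphic
in the open disc. -/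
def discAlgebra (δ : ℝ) : Subalgebra ℂ C(closedBall (0 : ℂ) δ, ℂ) where
  carrier := {f | ∃ F : ℂ → ℂ, DifferentiableOn ℂ F (ball 0 δ) ∧ ∀ t, f t = F t}
  mul_mem' := by
    rintro f g ⟨F, hF, hf⟩ ⟨G, hG, hg⟩
    exact ⟨F * G, hF.mul hG, fun t => by simp [hf, hg]⟩
  add_mem' := by
    rintro f g ⟨F, hF, hf⟩ ⟨G, hG, hg⟩
    exact ⟨F + G, hF.add hG, fun t => by simp [hf, hg]⟩
  algebraMap_mem' c := ⟨fun _ => c, differentiableOn_const c, fun t => by simp⟩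

namespace discAlgebra

variable {δ : ℝ}

/-- The element of the disc algebra given by a function on `ℂ`. -/
def mk (F : ℂ → ℂ) (hc : ContinuousOn F (closedBall 0 δ))
    (hd : DifferentiableOn ℂ F (ball 0 δ)) : discAlgebra δ :=
  ⟨⟨fun t => F t, continuousOn_iff_continuous_domRestrict.1 hc⟩, F, hd, fun _ => rfl⟩

@[simp] theorem mk_apply (F : ℂ → ℂ) (hc : ContinuousOn F (closedBall 0 δ))
    (hd : DifferentiableOn ℂ F (ball 0 δ)) (t : closedBall (0 : ℂ) δ) :
    (mk F hc hd : C(closedBall (0 : ℂ) δ, ℂ)) t = F t := rfl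

theorem ext_apply {f g : discAlgebra δ}
    (h : ∀ t, (f : C(closedBall (0 : ℂ) δ, ℂ)) t = (g : C(closedBall (0 : ℂ) δ, ℂ)) t) : f = g :=
  Subtype.ext (ContinuousMap.ext h)

/-- Uniform limits of holomorphic functions are holomorphic. The completeness that follows is what
inverting operators on the disc algebra requires. -/
theorem isClosed : IsClosed (discAlgebra δ : Set C(closedBall (0 : ℂ) δ, ℂ)) := by
  refine isClosed_of_closure_subset fun f hf => ?_
  obtain ⟨u, hu, hlim⟩ := mem_closure_iff_seq_limit.1 hf
  choose F hF huF using hu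
  have hsub : ∀ t ∈ ball (0 : ℂ) δ, t ∈ closedBall (0 : ℂ) δ := fun t ht => ball_subset_closedBall ht
  refine ⟨Function.extend Subtype.val f 0, ?_, fun t => (Subtype.val_injective.extend_apply f 0 t).symm⟩
  have hunif : TendstoUniformlyOn F (Function.extend Subtype.val f 0) Filter.atTop (ball 0 δ) := by
    have h := ContinuousMap.tendsto_iff_tendstoUniformly.1 hlim
    rw [Metric.tendstoUniformlyOn_iff]
    rw [Metric.tendstoUniformly_iff] at h
    intro ε hε
    filter_upwards [h ε hε] with k hk t ht
    have := hk ⟨t, hsub t ht⟩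
    rw [huF] at this
    rwa [show Function.extend Subtype.val f 0 t = f ⟨t, hsub t ht⟩ from
      Subtype.val_injective.extend_apply f 0 ⟨t, hsub t ht⟩]
  exact hunif.tendstoLocallyUniformlyOn.differentiableOn (Filter.Eventually.of_forall hF) isOpen_ball

instance : CompleteSpace (discAlgebra δ) := isClosed.completeSpace_coe

/-- The coordinate function. -/
def X : discAlgebra δ := mk id continuousOn_id differentiableOn_id

@[simp] theorem X_apply (t : closedBall (0 : ℂ) δ) :
    ((X : discAlgebra δ) : C(closedBall (0 : ℂ) δ, ℂ)) t = t := rfl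

/-- The quotient is the difference quotient `dslope F 0`, which stays continuous on the closed disc
because `0` is an interior point. -/
theorem exists_eq_add_X_mul (hδ : 0 < δ) (b : discAlgebra δ) :
    ∃ (c : ℂ) (q : discAlgebra δ), b = algebraMap ℂ _ c + X * q := by
  obtain ⟨f, F, hF, hf⟩ := b
  have hball : ball (0 : ℂ) δ ∈ 𝓝 0 := ball_mem_nhds _ hδ
  have hcb : closedBall (0 : ℂ) δ ∈ 𝓝 0 := closedBall_mem_nhds _ hδ
  have hc : ContinuousOn F (closedBall 0 δ) := by
    rw [continuousOn_iff_continuous_domRestrict]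
    convert f.continuous using 1
    ext t; exact (hf t).symm
  refine ⟨F 0, mk (dslope F 0) ?_ ?_, ?_⟩
  · exact (continuousOn_dslope hcb).2 ⟨hc, hF.differentiableAt hball⟩
  · exact (Complex.differentiableOn_dslope hball).2 hF
  · refine ext_apply fun t => ?_
    have := sub_smul_dslope F 0 (t : ℂ)
    simp only [sub_zero, smul_eq_mul] at this
    simp only [AddMemClass.coe_add, MulMemClass.coe_mul, ContinuousMap.add_apply,
      ContinuousMap.mul_apply, X_apply, mk_apply, this, hf]
    change F t = F 0 + _
    ring

theorem eq_zero_of_X_mul_eq_zero (hδ : 0 < δ) {q : discAlgebra δ} (h : X * q = 0) : q = 0 := by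
  obtain ⟨f, F, hF, hf⟩ := q
  have key : ∀ t : closedBall (0 : ℂ) δ, (t : ℂ) ≠ 0 → F t = 0 := by
    intro t ht
    have := congrArg (fun g : discAlgebra δ => (g : C(closedBall (0 : ℂ) δ, ℂ)) t) h
    simpa [ht, hf] using this
  have h0 : F 0 = 0 := by
    have hc : ContinuousAt F 0 := (hF.differentiableAt (ball_mem_nhds _ hδ)).continuousAt
    have h1 : Filter.Tendsto F (𝓝[≠] 0) (𝓝 (F 0)) := hc.tendsto.mono_left nhdsWithin_le_nhds
    have h2 : Filter.Tendsto F (𝓝[≠] 0) (𝓝 0) := by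
      refine Filter.Tendsto.congr' ?_ tendsto_const_nhds
      filter_upwards [self_mem_nhdsWithin, mem_nhdsWithin_of_mem_nhds (closedBall_mem_nhds 0 hδ)]
        with t ht ht'
      exact (key ⟨t, ht'⟩ ht).symm
    exact tendsto_nhds_unique h1 h2
  refine ext_apply fun t => ?_
  by_cases ht : (t : ℂ) = 0
  · simp [hf, ht, h0]
  · simp [hf, key t ht]

theorem division_surjective (hδ : 0 < δ) (d : ℕ) (b : discAlgebra δ) :
    ∃ (q : discAlgebra δ) (r : Fin d → ℂ), b = X ^ d * q + ∑ j, r j • X ^ (j : ℕ) := by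
  induction d with
  | zero => exact ⟨b, 0, by simp⟩
  | succ d ih =>
    obtain ⟨q, r, rfl⟩ := ih
    obtain ⟨c, q', rfl⟩ := exists_eq_add_X_mul hδ q
    refine ⟨q', Fin.snoc r c, ?_⟩
    simp only [Fin.sum_univ_castSucc, Fin.snoc_castSucc, Fin.snoc_last, Fin.val_castSucc,
      Fin.val_last, Algebra.algebraMap_eq_smul_one, mul_add, mul_smul_comm, mul_one, pow_succ]
    rw [mul_assoc]
    abel

theorem division_injective (hδ : 0 < δ) (d : ℕ) (q : discAlgebra δ) (r : Fin d → ℂ)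
    (h : X ^ d * q + ∑ j, r j • X ^ (j : ℕ) = 0) : q = 0 ∧ r = 0 := by
  induction d generalizing q with
  | zero => exact ⟨by simpa using h, Subsingleton.elim _ _⟩
  | succ d ih =>
    -- The top remainder term is absorbed into the quotient for exponent `d`. That quotient is zero,
    -- and its value at `0` is the top coefficient.
    have h' := ih (X * q + r (Fin.last d) • 1) (fun j => r j.castSucc) (by
      rw [← h, Fin.sum_univ_castSucc]
      simp only [Fin.val_castSucc, Fin.val_last, mul_add, mul_smul_comm, mul_one, pow_succ,
        mul_assoc]
      abel)
    have hr : r (Fin.last d) = 0 := by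
      have := congrArg (fun g : discAlgebra δ => (g : C(closedBall (0 : ℂ) δ, ℂ))
        ⟨0, mem_closedBall_self hδ.le⟩) h'.1
      simpa using this
    refine ⟨eq_zero_of_X_mul_eq_zero hδ (by
      have h1 := h'.1
      rwa [hr, zero_smul, add_zero] at h1), funext fun j => ?_⟩
    refine Fin.lastCases hr (fun i => ?_) j
    exact congrFun h'.2 i

end discAlgebra

/-! ### Holomorphic families as maps into the disc algebra. -/

section Curry

variable {E : Type*} [NormedAddCommGroup E] [NormedSpace ℂ E]

/-- A map into a closed subspace is `C^1` if it is so as a map into the ambient space. -/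
theorem contDiffAt_one_of_coe {B : Type*} [NormedAddCommGroup B] [NormedSpace ℂ B]
    (S : Submodule ℂ B) (hS : IsClosed (S : Set B)) {Γ : E → S} {D : E → E →L[ℂ] B} {z₀ : E}
    {u : Set E} (hu : u ∈ 𝓝 z₀) (hD : ContinuousOn D u)
    (hΓ : ∀ z ∈ u, HasFDerivAt (fun z => (Γ z : B)) (D z) z) : ContDiffAt ℂ 1 Γ z₀ := by
  -- Derivatives are limits of difference quotients, which lie in the closed subspace.
  have hmem : ∀ z ∈ u, ∀ h, D z h ∈ S := by
    intro z hz h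
    have hlim := (hΓ z hz).lim h (c := fun n : ℕ => (n : ℂ)) (l := Filter.atTop)
      (by simpa using tendsto_natCast_atTop_atTop (R := ℝ))
    exact hS.mem_of_tendsto hlim (Filter.Eventually.of_forall fun c =>
      S.smul_mem _ (S.sub_mem (Γ _).2 (Γ _).2))
  classical
  let D' : E → E →L[ℂ] S := fun z =>
    if hz : z ∈ u then (D z).codRestrict S (hmem z hz) else 0
  have hD' : ∀ z ∈ u, ∀ h, (D' z h : B) = D z h := by
    intro z hz h
    simp [D', hz]
  refine contDiffAt_one_iff.2 ⟨D', u, hu, ?_, ?_⟩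
  · rw [Metric.continuousOn_iff] at hD ⊢
    intro z hz ε hε
    obtain ⟨η, hη, h⟩ := hD z hz (ε / 2) (half_pos hε)
    refine ⟨η, hη, fun w hw hwz => ?_⟩
    have := h w hw hwz
    rw [dist_eq_norm] at this ⊢
    refine lt_of_le_of_lt ?_ (half_lt_self hε)
    refine ContinuousLinearMap.opNorm_le_bound _ (half_pos hε).le fun v => ?_
    change ‖(((D' w - D' z) v : S) : B)‖ ≤ _
    have h1 : (((D' w - D' z) v : S) : B) = (D w - D z) v := by
      simp [hD' w hw, hD' z hz]
    rw [h1]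
    exact (D w - D z).le_of_opNorm_le this.le v
  · intro z hz
    have := hΓ z hz
    rw [hasFDerivAt_iff_isLittleO] at this ⊢
    refine Asymptotics.IsLittleO.of_norm_left (this.norm_left.congr_left fun x => ?_)
    change _ = ‖((Γ x - Γ z - D' z (x - z) : S) : B)‖
    simp [hD' z hz]

variable [FiniteDimensional ℂ E]

/-- The derivative of the curried map is the partial derivative in `z`. Compactness of the closed
disc makes its continuity in `z` uniform in `t`, and the mean value inequality turns this into
differentiability in the sup norm. -/
theorem contDiffOn_curry_discAlgebra {δ : ℝ} {U : Set (E × ℂ)} (hU : IsOpen U) {V : Set E}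
    (hV : IsOpen V) (hVU : V ×ˢ closedBall (0 : ℂ) δ ⊆ U) {G : E × ℂ → ℂ}
    (hG : ContDiffOn ℂ 1 G U) :
    ∃ Γ : E → discAlgebra δ, ContDiffOn ℂ 1 Γ V ∧ ∀ z ∈ V, ∀ t : closedBall (0 : ℂ) δ,
      (Γ z : C(closedBall (0 : ℂ) δ, ℂ)) t = G (z, t) := by
  classical
  have hdiff : ∀ p ∈ U, HasFDerivAt G (fderiv ℂ G p) p := fun p hp =>
    ((hG.differentiableOn one_ne_zero).differentiableAt (hU.mem_nhds hp)).hasFDerivAt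
  have hcont : ContinuousOn (fderiv ℂ G) U := hG.continuousOn_fderiv_of_isOpen hU le_rfl
  have hmem : ∀ z ∈ V, ∀ t ∈ closedBall (0 : ℂ) δ, (z, t) ∈ U := fun z hz t ht => hVU ⟨hz, ht⟩
  let Γ : E → discAlgebra δ := fun z =>
    if hz : z ∈ V then discAlgebra.mk (fun t => G (z, t))
      (hG.continuousOn.comp (by fun_prop) fun t ht => hmem z hz t ht)
      (fun t ht => ((hdiff _ (hmem z hz t (ball_subset_closedBall ht))).differentiableAt.comp t
        (by fun_prop)).differentiableWithinAt) else 0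
  have hΓ : ∀ z ∈ V, ∀ t : closedBall (0 : ℂ) δ,
      (Γ z : C(closedBall (0 : ℂ) δ, ℂ)) t = G (z, t) := by
    intro z hz t
    simp only [Γ, hz, dite_true]
    rfl
  have hDc : ∀ z ∈ V, ∀ h : E, Continuous
      (fun t : closedBall (0 : ℂ) δ => fderiv ℂ G (z, (t : ℂ)) (h, 0)) := by
    intro z hz h
    have : Continuous (fun t : closedBall (0 : ℂ) δ => fderiv ℂ G (z, (t : ℂ))) :=
      hcont.comp_continuous (by fun_prop) (fun t => hmem z hz t t.2)
    exact this.clm_apply continuous_const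
  let D : E → E →L[ℂ] C(closedBall (0 : ℂ) δ, ℂ) := fun z =>
    if hz : z ∈ V then LinearMap.toContinuousLinearMap
      { toFun := fun h => ⟨_, hDc z hz h⟩
        map_add' := fun a b => by
          ext t
          have : ((a + b, 0) : E × ℂ) = (a, 0) + (b, 0) := by simp
          simp [this, -Prod.mk_add_mk]
        map_smul' := fun c a => by
          ext t
          have : ((c • a, 0) : E × ℂ) = c • (a, 0) := by simp
          simp [this, -Prod.smul_mk] } else 0
  have hD : ∀ z ∈ V, ∀ h t, D z h t = fderiv ℂ G (z, (t : ℂ)) (h, 0) := by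
    intro z hz h t
    simp [D, hz]
  have hnear : ∀ z ∈ V, ∀ ε > 0, ∃ η > 0, ball z η ⊆ V ∧ ∀ w ∈ ball z η,
      ∀ t ∈ closedBall (0 : ℂ) δ, ‖fderiv ℂ G (w, t) - fderiv ℂ G (z, t)‖ ≤ ε := by
    intro z hz ε hε
    have h1 : ∀ᶠ w in 𝓝 z, ∀ t ∈ closedBall (0 : ℂ) δ,
        ‖fderiv ℂ G (w, t) - fderiv ℂ G (z, t)‖ ≤ ε := by
      refine (isCompact_closedBall (0 : ℂ) δ).eventually_forall_of_forall_eventually fun t ht => ?_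
      have hc : ContinuousAt (fderiv ℂ G) (z, t) := hcont.continuousAt (hU.mem_nhds (hmem z hz t ht))
      have hc' : Filter.Tendsto (fun p : E × ℂ => fderiv ℂ G (z, p.2)) (𝓝 (z, t))
          (𝓝 (fderiv ℂ G (z, t))) :=
        hc.tendsto.comp (f := fun p : E × ℂ => (z, p.2))
          (Continuous.tendsto' (by fun_prop) _ _ rfl)
      have h2 := (hc.tendsto.sub hc').norm
      rw [sub_self, norm_zero] at h2
      filter_upwards [h2.eventually (Iio_mem_nhds hε)] with p hp using le_of_lt hp
    obtain ⟨η, hη, h⟩ := Metric.mem_nhds_iff.1 (Filter.inter_mem h1 (hV.mem_nhds hz))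
    exact ⟨η, hη, fun w hw => (h hw).2, fun w hw => (h hw).1⟩
  refine ⟨Γ, fun z hz => ContDiffAt.contDiffWithinAt ?_, hΓ⟩
  refine contDiffAt_one_of_coe (Subalgebra.toSubmodule (discAlgebra δ)) discAlgebra.isClosed
    (D := D) (u := V) (hV.mem_nhds hz) ?_ ?_
  · rw [Metric.continuousOn_iff]
    intro z hz ε hε
    obtain ⟨η, hη, hηV, h⟩ := hnear z hz (ε / 2) (half_pos hε)
    refine ⟨η, hη, fun w hw hwz => ?_⟩
    rw [dist_eq_norm]
    refine lt_of_le_of_lt ?_ (half_lt_self hε)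
    refine ContinuousLinearMap.opNorm_le_bound _ (half_pos hε).le fun v => ?_
    refine (ContinuousMap.norm_le _ (by positivity)).2 fun t => ?_
    have h1 : (D w - D z) v t = (fderiv ℂ G (w, (t : ℂ)) - fderiv ℂ G (z, (t : ℂ))) (v, 0) := by
      simp [hD w hw, hD z hz]
    rw [h1]
    refine (ContinuousLinearMap.le_of_opNorm_le _ (h w hwz t t.2) _).trans ?_
    simp [Prod.norm_def]
  · intro z hz
    rw [hasFDerivAt_iff_isLittleO, Asymptotics.isLittleO_iff]
    intro ε hε
    obtain ⟨η, hη, hηV, h⟩ := hnear z hz ε hε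
    filter_upwards [ball_mem_nhds z hη] with w hw
    refine (ContinuousMap.norm_le _ (by positivity)).2 fun t => ?_
    have h1 : ((Γ w : C(closedBall (0 : ℂ) δ, ℂ)) - Γ z - D z (w - z)) t
        = G (w, t) - G (z, t) - (fderiv ℂ G (z, (t : ℂ)) ∘L .inl ℂ E ℂ) (w - z) := by
      simp only [ContinuousMap.sub_apply, hΓ w (hηV hw), hΓ z hz, hD z hz]
      rfl
    change ‖((Γ w : C(closedBall (0 : ℂ) δ, ℂ)) - Γ z - D z (w - z)) t‖ ≤ _
    rw [h1]
    let _ : NormedSpace ℝ E := NormedSpace.restrictScalars ℝ ℂ E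
    refine (convex_ball z η).norm_image_sub_le_of_norm_hasFDerivWithin_le'
      (f := fun w => G (w, (t : ℂ))) (f' := fun w => fderiv ℂ G (w, (t : ℂ)) ∘L .inl ℂ E ℂ)
      (fun x hx => ?_) (fun x hx => ?_) (mem_ball_self hη) hw
    · have := (hdiff _ (hmem x (hηV hx) t t.2)).comp x (f := fun w : E => (w, (t : ℂ)))
        ((hasFDerivAt_id x).prodMk (hasFDerivAt_const (t : ℂ) x))
      exact this.hasFDerivWithinAt
    · rw [← ContinuousLinearMap.sub_comp]
      refine (ContinuousLinearMap.opNorm_comp_le _ _).trans ?_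
      refine (mul_le_mul (h x hx t t.2) (ContinuousLinearMap.norm_inl_le_one ℂ E ℂ)
        (norm_nonneg _) hε.le).trans_eq (mul_one ε)

end Curry

/-! ### Weierstrass division on a common neighbourhood. -/

section Remainder

theorem contDiff_mulLeft {A : Type*} [NormedRing A] [NormedAlgebra ℂ A] :
    ContDiff ℂ 1 fun a : A => ContinuousLinearMap.mul ℂ A a :=
  (ContinuousLinearMap.mul ℂ A).contDiff

open discAlgebra

variable {E : Type*} [NormedAddCommGroup E] [NormedSpace ℂ E] [FiniteDimensional ℂ E]

/-- Weierstrass division with remainder on a neighbourhood that does not depend on the dividend. -/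
theorem exists_weierstrass_remainder {ι : Type*} {U : Set (E × ℂ)} (hU : IsOpen U)
    (h0 : ((0 : E), (0 : ℂ)) ∈ U) (g : ι → E × ℂ → ℂ) (hg : ∀ i, ContDiffOn ℂ 1 (g i) U) (i₀ : ι)
    (hne : ¬ ∀ᶠ t in 𝓝 (0 : ℂ), g i₀ (0, t) = 0) :
    ∃ (d : ℕ) (V : Set E) (δ : ℝ) (r : ι → E → Fin d → ℂ), IsOpen V ∧ 0 ∈ V ∧ 0 < δ ∧
      (∀ i, ContDiffOn ℂ 1 (r i) V) ∧ ∀ z ∈ V, ∀ t ∈ closedBall (0 : ℂ) δ,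
        g i₀ (z, t) = 0 → ∀ i, g i (z, t) = ∑ j, r i z j * t ^ (j : ℕ) := by
  have hU' : IsOpen {t : ℂ | ((0 : E), t) ∈ U} := hU.preimage (by fun_prop)
  have hf : AnalyticAt ℂ (fun t => g i₀ (0, t)) 0 := by
    refine DifferentiableOn.analyticAt (s := {t : ℂ | ((0 : E), t) ∈ U}) (fun t ht => ?_)
      (hU'.mem_nhds h0)
    exact ((((hg i₀).differentiableOn one_ne_zero).differentiableAt (hU.mem_nhds ht)).comp t
      (f := fun t : ℂ => ((0 : E), t)) (by fun_prop)).differentiableWithinAt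
  obtain ⟨d, u, hu, hu0, hfu⟩ := hf.exists_eventuallyEq_pow_smul_nonzero_iff.2 hne
  have hev : ∀ᶠ t in 𝓝 (0 : ℂ), ((0 : E), t) ∈ U ∧ u t ≠ 0 ∧ AnalyticAt ℂ u t ∧
      g i₀ (0, t) = (t - 0) ^ d • u t :=
    Filter.Eventually.and (hU'.mem_nhds h0)
      ((hu.continuousAt.eventually_ne hu0).and (hu.eventually_analyticAt.and hfu))
  obtain ⟨δ, hδ, hball⟩ := nhds_basis_closedBall.eventually_iff.1 hev
  obtain ⟨V₀, W, hV₀, -, h0V, hW, hVW⟩ := generalized_tube_lemma (isCompact_singleton (x := (0 : E)))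
    (isCompact_closedBall (0 : ℂ) δ) hU (by rintro ⟨z, t⟩ ⟨rfl, ht⟩; exact (hball ht).1)
  have hVU : V₀ ×ˢ closedBall (0 : ℂ) δ ⊆ U := (Set.prod_mono_right hW).trans hVW
  choose Γ hΓ hΓg using fun i => contDiffOn_curry_discAlgebra hU hV₀ hVU (hg i)
  have h0V : (0 : E) ∈ V₀ := h0V rfl
  let P : (Fin d → ℂ) →L[ℂ] discAlgebra δ :=
    ∑ j : Fin d, (ContinuousLinearMap.proj (R := ℂ) (φ := fun _ : Fin d => ℂ) j).smulRight ((X : discAlgebra δ) ^ (j : ℕ))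
  have hP : ∀ r, P r = ∑ j, r j • (X : discAlgebra δ) ^ (j : ℕ) := fun r => by simp [P]
  -- Division by `g i₀ (z, ·)` is inversion of `T z`. At `z = 0` the divisor is `t ^ d` times a
  -- unit, so `T 0` is bijective by division by `X ^ d`. Invertibility is an open condition on `T
  -- z`, and `T` involves only the divisor, so the neighbourhood serves all dividends.
  let T : E → (discAlgebra δ × (Fin d → ℂ)) →L[ℂ] discAlgebra δ := fun z =>
    (ContinuousLinearMap.mul ℂ (discAlgebra δ) (Γ i₀ z)) ∘L .fst ℂ _ _ + P ∘L .snd ℂ _ _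
  have hT : ∀ z q r, T z (q, r) = Γ i₀ z * q + ∑ j, r j • (X : discAlgebra δ) ^ (j : ℕ) := by
    intro z q r
    simp [T, hP]
  have hTc : ContDiffOn ℂ 1 T V₀ := by
    refine ContDiffOn.add (ContDiffOn.clm_comp ?_ contDiffOn_const) contDiffOn_const
    exact (contDiff_mulLeft (A := discAlgebra δ)).comp_contDiffOn (hΓ i₀)
  let v : discAlgebra δ := mk u (fun t ht => (hball ht).2.2.1.continuousAt.continuousWithinAt)
    (fun t ht => (hball (ball_subset_closedBall ht)).2.2.1.differentiableAt.differentiableWithinAt)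
  let w : discAlgebra δ := mk (fun t => (u t)⁻¹)
    (fun t ht => ((hball ht).2.2.1.continuousAt.inv₀ (hball ht).2.1).continuousWithinAt)
    (fun t ht => ((hball (ball_subset_closedBall ht)).2.2.1.differentiableAt.inv
      (hball (ball_subset_closedBall ht)).2.1).differentiableWithinAt)
  have hvw : v * w = 1 := by
    refine ext_apply fun t => ?_
    exact mul_inv_cancel₀ (hball t.2).2.1
  have hΓ0 : Γ i₀ 0 = X ^ d * v := by
    refine ext_apply fun t => ?_
    rw [hΓg i₀ 0 h0V t, (hball t.2).2.2.2, sub_zero]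
    rfl
  have hinj : (T 0).toLinearMap.ker = ⊥ := by
    rw [LinearMap.ker_eq_bot']
    rintro ⟨q, r⟩ h
    have h1 : T 0 (q, r) = 0 := h
    rw [hT, hΓ0, mul_assoc] at h1
    obtain ⟨h2, h3⟩ := division_injective hδ d _ _ h1
    have : q = w * (v * q) := by rw [← mul_assoc, mul_comm w, hvw, one_mul]
    rw [h2, mul_zero] at this
    rw [this, h3]; rfl
  have hsurj : (T 0).toLinearMap.range = ⊤ := by
    rw [LinearMap.range_eq_top]
    intro b
    obtain ⟨q, r, rfl⟩ := division_surjective hδ d b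
    refine ⟨(w * q, r), ?_⟩
    change T 0 (w * q, r) = _
    rw [hT, hΓ0, mul_assoc, ← mul_assoc v, hvw, one_mul]
  let e := ContinuousLinearEquiv.ofBijective (T 0) hinj hsurj
  have he : (e : _ →L[ℂ] discAlgebra δ) = T 0 := ContinuousLinearEquiv.coe_ofBijective _ _ _
  let S : Set ((discAlgebra δ × (Fin d → ℂ)) →L[ℂ] discAlgebra δ) :=
    Set.range ContinuousLinearEquiv.toContinuousLinearMap
  have hS : IsOpen S := ContinuousLinearEquiv.isOpen
  refine ⟨d, V₀ ∩ T ⁻¹' S, δ, fun i z => ((T z).inverse (Γ i z)).2,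
    hTc.continuousOn.isOpen_inter_preimage hV₀ hS, ⟨h0V, e, he⟩, hδ, fun i z hz => ?_, ?_⟩
  · obtain ⟨hz, e', he'⟩ := hz
    have h1 : ContDiffAt ℂ 1 (fun z => (T z).inverse) z := by
      refine ContDiffAt.comp (g := ContinuousLinearMap.inverse) z ?_ (hTc.contDiffAt (hV₀.mem_nhds hz))
      rw [← he']
      exact contDiffAt_map_inverse e'
    exact (contDiff_snd.contDiffAt.comp z
      (h1.clm_apply ((hΓ i).contDiffAt (hV₀.mem_nhds hz)))).contDiffWithinAt
  · rintro z ⟨hz, e', he'⟩ t ht h i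
    have h1 : T z ((T z).inverse (Γ i z)) = Γ i z := by
      rw [← he', ContinuousLinearMap.inverse_equiv]
      exact e'.apply_symm_apply _
    rw [← Prod.mk.eta (p := (T z).inverse (Γ i z)), hT] at h1
    have h2 := congrArg (fun f : discAlgebra δ => (f : C(closedBall (0 : ℂ) δ, ℂ)) ⟨t, ht⟩) h1
    have h3 := hΓg i₀ z hz ⟨t, ht⟩
    -- At a zero of the divisor the quotient term drops out and only the remainder is left.
    rw [h] at h3
    simp only [hΓg i z hz ⟨t, ht⟩] at h2
    rw [← h2]
    simp [h3]

end Remainder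

/-! ### Common zeros of infinite families of holomorphic functions. -/

section Stabilization

universe u v

/-- Near `x₀`, the common zeros of the family `f` are those of a finite subfamily. -/
def HasFiniteZeroSubfamily {E : Type u} [TopologicalSpace E] {ι : Type v} (f : ι → E → ℂ)
    (U : Set E) (x₀ : E) : Prop :=
  ∃ (J : Finset ι) (V : Set E), IsOpen V ∧ x₀ ∈ V ∧ V ⊆ U ∧
    ∀ z ∈ V, (∀ i ∈ J, f i z = 0) → ∀ i, f i z = 0

/-- A left inverse of the coordinate map sends `b` to the standard basis. Being a fixed projection,
it can be applied to vectors depending holomorphically on `z`, so that rank is detected by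
holomorphic determinants. -/
theorem exists_linearMap_det_eq_one {k d : ℕ} {b : Fin k → Fin d → ℂ}
    (hb : LinearIndependent ℂ b) :
    ∃ g : (Fin d → ℂ) →ₗ[ℂ] (Fin k → ℂ), Matrix.det (fun a c => g (b a) c) = 1 := by
  have hker : (Fintype.linearCombination ℂ b).ker = ⊥ := LinearMap.ker_eq_bot'.2 fun c hc =>
    funext (Fintype.linearIndependent_iff.1 hb c (by simpa [Fintype.linearCombination_apply] using hc))
  obtain ⟨g, hg⟩ := LinearMap.exists_leftInverse_of_injective _ hker
  refine ⟨g, ?_⟩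
  have h2 : (fun a c => g (b a) c) = (1 : Matrix (Fin k) (Fin k) ℂ) := by
    ext a c
    have h3 := LinearMap.congr_fun hg (Pi.single a 1)
    have h4 : Fintype.linearCombination ℂ b (Pi.single a 1) = b a := by
      simp [Fintype.linearCombination_apply_single]
    rw [LinearMap.comp_apply, h4] at h3
    rw [h3, Matrix.one_apply]
    simp [Pi.single_apply, eq_comm]
  exact (congrArg Matrix.det h2).trans Matrix.det_one

/-- Stabilization of pointwise spans from stabilization of common zeros. -/
theorem exists_finset_span_eq {E : Type u} [NormedAddCommGroup E] [NormedSpace ℂ E]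
    {V : Set E} {x₀ : E}
    (H : ∀ (κ : Type v) (f : κ → E → ℂ), (∀ i, ContDiffOn ℂ 1 (f i) V) →
      HasFiniteZeroSubfamily f V x₀)
    {ι : Type v} {d : ℕ} (r : ι → E → Fin d → ℂ) (hr : ∀ i, ContDiffOn ℂ 1 (r i) V) :
    ∃ (J : Finset ι) (V' : Set E), IsOpen V' ∧ x₀ ∈ V' ∧ V' ⊆ V ∧
      ∀ z ∈ V', ∀ i, r i z ∈ Submodule.span ℂ ((fun j => r j z) '' (J : Set ι)) := by
  classical
  -- Rank at least `k` means that some `k`-by-`k` determinant, over all choices of vectors and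
  -- projections, is nonzero. For each `k ≤ d`, `H` reduces their simultaneous vanishing to finitely
  -- many of them.
  have hdet : ∀ k : Fin (d + 1), HasFiniteZeroSubfamily
      (fun (p : (Fin k → ι) × ((Fin d → ℂ) →ₗ[ℂ] (Fin k → ℂ))) z =>
        Matrix.det fun a b => p.2 (r (p.1 a) z) b) V x₀ := by
    intro k
    refine H _ _ fun p => ?_
    have h1 : ∀ a b, ContDiffOn ℂ 1 (fun z => p.2 (r (p.1 a) z) b) V := by
      intro a b
      have := (LinearMap.toContinuousLinearMap p.2).contDiff.comp_contDiffOn (n := 1) (hr (p.1 a))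
      exact contDiffOn_pi.1 this b
    have h2 : (fun z => Matrix.det fun a b => p.2 (r (p.1 a) z) b) = fun z =>
        ∑ σ : Equiv.Perm (Fin k), (Equiv.Perm.sign σ : ℂ) * ∏ i, p.2 (r (p.1 (σ i)) z) i := by
      funext z
      exact Matrix.det_apply' _
    rw [h2]
    exact ContDiffOn.sum fun σ _ => contDiffOn_const.mul (contDiffOn_prod fun i _ => h1 _ _)
  choose J V' hV' hxV' hV'V hJ using hdet
  refine ⟨Finset.univ.biUnion fun k => (J k).biUnion fun p => Finset.univ.image p.1, ⋂ k, V' k,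
    isOpen_iInter_of_finite hV', Set.mem_iInter.2 hxV',
    (Set.iInter_subset _ (0 : Fin (d + 1))).trans (hV'V 0), fun z hz => ?_⟩
  set K : Finset ι := Finset.univ.biUnion fun k => (J k).biUnion fun p => Finset.univ.image p.1
  set S := Submodule.span ℂ (Set.range fun i => r i z) with hS
  have hkd : Module.finrank ℂ S < d + 1 := by
    have := Submodule.finrank_le S
    rw [Module.finrank_fin_fun] at this
    omega
  obtain ⟨b, hb, -, hli⟩ := Submodule.exists_fun_fin_finrank_span_eq ℂ (Set.range fun i => r i z)
  choose s hs using hb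
  -- Here `k` is the rank at `z`. If the finitely many chosen determinants vanished at `z`, all
  -- would, including the one attached to a basis of the span.
  have hex : ∃ p ∈ J ⟨_, hkd⟩, (Matrix.det fun a b => p.2 (r (p.1 a) z) b) ≠ 0 := by
    by_contra! hcon
    have hall := hJ ⟨_, hkd⟩ z (Set.mem_iInter.1 hz _) hcon
    obtain ⟨g, hg⟩ := exists_linearMap_det_eq_one hli
    have h1 := hall (s, g)
    have h2 : (fun a => r (s a) z) = b := funext hs
    refine one_ne_zero (α := ℂ) (hg.symm.trans ?_)
    rw [← h2]
    exact h1
  obtain ⟨p, hp, hpd⟩ := hex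
  have hli' : LinearIndependent ℂ fun a => r (p.1 a) z := by
    have := Matrix.linearIndependent_rows_of_det_ne_zero hpd
    exact LinearIndependent.of_comp p.2 this
  have hle1 : Submodule.span ℂ (Set.range fun a => r (p.1 a) z) ≤
      Submodule.span ℂ ((fun j => r j z) '' (K : Set ι)) := by
    refine Submodule.span_mono ?_
    rintro _ ⟨a, rfl⟩
    refine ⟨p.1 a, ?_, rfl⟩
    simp only [K, Finset.mem_coe, Finset.mem_biUnion, Finset.mem_univ, true_and, Finset.mem_image]
    exact ⟨_, p, hp, a, rfl⟩
  have hle2 : Submodule.span ℂ ((fun j => r j z) '' (K : Set ι)) ≤ S :=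
    Submodule.span_mono (Set.image_subset_range _ _)
  have heq : Submodule.span ℂ ((fun j => r j z) '' (K : Set ι)) = S := by
    refine Submodule.eq_of_le_of_finrank_le hle2 ?_
    have h1 := finrank_span_eq_card hli'
    rw [Fintype.card_fin] at h1
    exact h1.symm.le.trans (Submodule.finrank_mono hle1)
  intro i
  rw [heq]
  exact Submodule.subset_span ⟨i, rfl⟩

/-- The common zero set of a family of holomorphic functions on a common domain is locally the
common zero set of a finite subfamily. -/
theorem hasFiniteZeroSubfamily_of_contDiffOn (n : ℕ) :
    ∀ (E : Type u) [NormedAddCommGroup E] [NormedSpace ℂ E] [FiniteDimensional ℂ E],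
      Module.finrank ℂ E = n → ∀ (ι : Type v) (f : ι → E → ℂ) (U : Set E) (x₀ : E), IsOpen U →
        x₀ ∈ U → (∀ i, ContDiffOn ℂ 1 (f i) U) → HasFiniteZeroSubfamily f U x₀ := by
  induction n with
  | zero =>
    intro E _ _ _ hE ι f U x₀ hU hx₀ hf
    have : Subsingleton E := Module.finrank_zero_iff.1 hE
    by_cases h : ∃ i, f i x₀ ≠ 0
    · obtain ⟨i, hi⟩ := h
      refine ⟨{i}, U, hU, hx₀, subset_rfl, fun z _ hz => ?_⟩
      rw [Subsingleton.elim z x₀] at hz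
      exact absurd (hz i (Finset.mem_singleton_self i)) hi
    · push Not at h
      exact ⟨∅, U, hU, hx₀, subset_rfl, fun z _ _ i => by rw [Subsingleton.elim z x₀, h]⟩
  | succ n ih =>
    intro E _ _ _ hE ι f U x₀ hU hx₀ hf
    classical
    obtain ⟨ε, hε, hball⟩ := Metric.isOpen_iff.1 hU x₀ hx₀
    by_cases hall : ∀ i, ∀ z ∈ ball x₀ ε, f i z = 0
    · exact ⟨∅, ball x₀ ε, isOpen_ball, mem_ball_self hε, hball, fun z hz _ i => hall i z hz⟩
    push Not at hall
    obtain ⟨i₀, x₁, hx₁, hfx₁⟩ := hall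
    by_cases hv : x₁ = x₀
    · subst hv
      refine ⟨{i₀}, U ∩ f i₀ ⁻¹' {0}ᶜ, (hf i₀).continuousOn.isOpen_inter_preimage hU
        isOpen_compl_singleton, ⟨hx₀, hfx₁⟩, Set.inter_subset_left, fun z hz h => ?_⟩
      exact absurd (h i₀ (Finset.mem_singleton_self _)) hz.2
    -- Coordinates `ker l × ℂ w` centred at `x₀`. Since `w` points to a point of the ball where `f
    -- i₀` is nonzero, `f i₀` does not vanish identically near `x₀` on the line of direction `w`, as
    -- Weierstrass division requires.
    set w := x₁ - x₀ with hw
    have hw0 : w ≠ 0 := sub_ne_zero.2 hv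
    obtain ⟨l, hl⟩ := SeparatingDual.exists_eq_one (R := ℂ) hw0
    let E' := LinearMap.ker l.toLinearMap
    have hE' : Module.finrank ℂ E' = n := by
      have h1 : (l.toLinearMap : Module.Dual ℂ E) ≠ 0 := by
        intro h
        have := LinearMap.congr_fun h w
        rw [show l.toLinearMap w = 1 from hl] at this
        simp at this
      have := Module.Dual.finrank_ker_add_one_of_ne_zero h1
      rw [hE] at this
      exact Nat.succ_injective this
    let A : E' × ℂ → E := fun p => x₀ + p.1 + p.2 • w
    have hA : ContDiff ℂ 1 A := by
      refine (contDiff_const.add ?_).add (contDiff_snd.smul contDiff_const)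
      exact E'.subtypeL.contDiff.comp contDiff_fst
    have hker : ∀ y : E, y - x₀ - l (y - x₀) • w ∈ E' := by
      intro y
      change l (y - x₀ - l (y - x₀) • w) = 0
      rw [map_sub, map_smul, hl, smul_eq_mul, mul_one, sub_self]
    let π : E → E' := fun y => ⟨y - x₀ - l (y - x₀) • w, hker y⟩
    have hπ : Continuous π := Continuous.subtype_mk (by fun_prop) _
    have hAπ : ∀ y, A (π y, l (y - x₀)) = y := by
      intro y
      simp only [A, π]
      abel
    have hU' : IsOpen (A ⁻¹' U) := hU.preimage hA.continuous
    have hA0 : A (0, 0) = x₀ := by simp [A]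
    obtain ⟨d, V₁, δ, r, hV₁, h0V₁, hδ, hr, hrem⟩ := exists_weierstrass_remainder hU'
      (by rw [Set.mem_preimage, hA0]; exact hx₀) (fun i p => f i (A p))
      (fun i => (hf i).comp hA.contDiffOn fun p hp => hp) i₀ (by
        intro hzero
        have hAt : ∀ t : ℂ, A (0, t) = x₀ + t • w := fun t => by simp [A]
        simp only [hAt] at hzero
        have hwpos : 0 < ‖w‖ := norm_pos_iff.2 hw0
        have hin : ∀ t ∈ ball (0 : ℂ) (ε / ‖w‖), x₀ + t • w ∈ ball x₀ ε := by
          intro t ht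
          rw [mem_ball_zero_iff, lt_div_iff₀ hwpos] at ht
          simpa [norm_smul] using ht
        have han : AnalyticOnNhd ℂ (fun t : ℂ => f i₀ (x₀ + t • w)) (ball 0 (ε / ‖w‖)) := by
          refine DifferentiableOn.analyticOnNhd (fun t ht => ?_) isOpen_ball
          exact ((((hf i₀).differentiableOn one_ne_zero).differentiableAt
            (hU.mem_nhds (hball (hin t ht)))).comp t (f := fun t : ℂ => x₀ + t • w)
            (by fun_prop)).differentiableWithinAt
        have h1 := han.eqOn_zero_of_preconnected_of_eventuallyEq_zero
          (convex_ball _ _).isPreconnected (mem_ball_self (by positivity)) hzero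
        have h2 : (1 : ℂ) ∈ ball (0 : ℂ) (ε / ‖w‖) := by
          rw [mem_ball_zero_iff, norm_one, one_lt_div hwpos]
          simpa [hw, dist_eq_norm] using hx₁
        refine hfx₁ ?_
        have := h1 h2
        simpa [hw] using this)
    -- The remainder coefficients live on `ker l`, of one dimension less, so the induction
    -- hypothesis applies to their determinants.
    obtain ⟨J, V₂, hV₂, h0V₂, hV₂V₁, hspan⟩ := exists_finset_span_eq
      (fun κ g hg => ih E' hE' κ g V₁ 0 hV₁ h0V₁ hg) r hr
    refine ⟨insert i₀ J, U ∩ (π ⁻¹' V₂ ∩ (fun y => l (y - x₀)) ⁻¹' ball 0 δ),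
      hU.inter ((hV₂.preimage hπ).inter (isOpen_ball.preimage (by fun_prop))), ⟨hx₀, ?_, ?_⟩,
      Set.inter_subset_left, ?_⟩
    · have : π x₀ = 0 := by ext; simp [π]
      rw [Set.mem_preimage, this]; exact h0V₂
    · simpa using hδ
    · rintro y ⟨-, hy, hyl⟩ hzero i
      have hrem' := hrem (π y) (hV₂V₁ hy) (l (y - x₀)) (ball_subset_closedBall hyl)
      simp only [hAπ] at hrem'
      have hrem'' := hrem' (hzero i₀ (Finset.mem_insert_self _ _))
      rw [hrem'' i]
      -- Where `f i₀ = 0`, the value of `f i` is `φ` applied to its remainder vector. If `φ` kills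
      -- the vectors indexed by `J`, it kills their span, which contains all the others.
      let φ : (Fin d → ℂ) →ₗ[ℂ] ℂ := ∑ j : Fin d, (l (y - x₀) ^ (j : ℕ)) • LinearMap.proj j
      have hφ : ∀ c, φ c = ∑ j, c j * l (y - x₀) ^ (j : ℕ) := by
        intro c
        simp [φ, mul_comm]
      rw [← hφ]
      have hle : Submodule.span ℂ ((fun j => r j (π y)) '' (J : Set ι)) ≤ LinearMap.ker φ := by
        rw [Submodule.span_le]
        rintro _ ⟨j, hj, rfl⟩
        change φ _ = 0
        rw [hφ, ← hrem'' j]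
        exact hzero j (Finset.mem_insert_of_mem hj)
      exact hle (hspan (π y) hy i)

end Stabilization

/-! ### Complexification of real-analytic functions. -/

section Complexification

/-- The power series is complexified term by term through its coefficients on the standard basis. A
term of degree `k` has `c ^ k` coefficients, `c` the number of variables, so the norm grows at most
by that factor and the radius stays positive. -/
theorem exists_holomorphic_extension {ι : Type*} [Fintype ι] {f : (ι → ℝ) → ℝ} {a : ι → ℝ}
    (hf : AnalyticAt ℝ f a) :
    ∃ F : (ι → ℂ) → ℂ, AnalyticAt ℂ F (fun i => (a i : ℂ)) ∧
      ∀ᶠ x in 𝓝 a, F (fun i => (x i : ℂ)) = f x := by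
  classical
  obtain ⟨p, hp⟩ := hf
  let P : FormalMultilinearSeries ℂ (ι → ℂ) ℂ := fun k =>
    ∑ s : Fin k → ι, (p k (fun i => Pi.single (s i) 1) : ℂ) •
      (ContinuousMultilinearMap.mkPiAlgebra ℂ (Fin k) ℂ).compContinuousLinearMap
        (fun i => ContinuousLinearMap.proj (R := ℂ) (φ := fun _ : ι => ℂ) (s i))
  have hP : ∀ k (y : ι → ℂ), P k (fun _ => y) =
      ∑ s : Fin k → ι, (p k (fun i => Pi.single (s i) 1) : ℂ) * ∏ i, y (s i) := by
    intro k y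
    simp [P]
  have hPreal : ∀ k (y : ι → ℝ), P k (fun _ i => (y i : ℂ)) = ((p k fun _ => y : ℝ) : ℂ) := by
    intro k y
    rw [hP]
    have h1 : y = ∑ i, y i • (Pi.single i 1 : ι → ℝ) := by
      ext j
      simp [Pi.single_apply]
    have h2 : (p k fun _ => y) = ∑ s : Fin k → ι, (∏ i, y (s i)) * p k (fun i => Pi.single (s i) 1) := by
      conv_lhs => rw [h1]
      rw [ContinuousMultilinearMap.map_sum]
      refine Finset.sum_congr rfl fun s _ => ?_
      exact (p k).map_smul_univ _ _
    rw [h2]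
    push_cast
    exact Finset.sum_congr rfl fun s _ => mul_comm _ _
  set c : ℝ := ((Fintype.card ι : ℕ) : ℝ) with hc
  have hc0 : 0 ≤ c := Nat.cast_nonneg _
  have hnorm : ∀ k, ‖P k‖ ≤ c ^ k * ‖p k‖ := by
    intro k
    refine (norm_sum_le _ _).trans ?_
    have h1 : ∀ s : Fin k → ι, ‖(p k (fun i => Pi.single (s i) 1) : ℂ) •
        (ContinuousMultilinearMap.mkPiAlgebra ℂ (Fin k) ℂ).compContinuousLinearMap
        (fun i => ContinuousLinearMap.proj (R := ℂ) (φ := fun _ : ι => ℂ) (s i))‖ ≤ ‖p k‖ := by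
      intro s
      rw [norm_smul]
      have h2 : ‖(p k (fun i => Pi.single (s i) 1) : ℂ)‖ ≤ ‖p k‖ := by
        rw [Complex.norm_real]
        refine ((p k).le_opNorm _).trans ?_
        refine mul_le_of_le_one_right (norm_nonneg _) (Finset.prod_le_one (fun _ _ => norm_nonneg _)
          fun i _ => ?_)
        rw [Pi.norm_single, norm_one]
      have h3 : ‖(ContinuousMultilinearMap.mkPiAlgebra ℂ (Fin k) ℂ).compContinuousLinearMap
          (fun i => ContinuousLinearMap.proj (R := ℂ) (φ := fun _ : ι => ℂ) (s i))‖ ≤ 1 := by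
        refine ContinuousMultilinearMap.opNorm_le_bound zero_le_one fun m => ?_
        simp only [ContinuousMultilinearMap.compContinuousLinearMap_apply,
          ContinuousMultilinearMap.mkPiAlgebra_apply, norm_prod, one_mul]
        exact Finset.prod_le_prod (fun _ _ => norm_nonneg _) fun i _ => norm_le_pi_norm (m i) (s i)
      exact (mul_le_mul h2 h3 (norm_nonneg _) (norm_nonneg _)).trans_eq (mul_one _)
    refine (Finset.sum_le_sum fun s _ => h1 s).trans_eq ?_
    simp [hc]
  obtain ⟨ρ, hρ0, hρ⟩ := ENNReal.lt_iff_exists_nnreal_btwn.1 hp.radius_pos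
  have hρ0' : (0 : ℝ) < ρ := by exact_mod_cast hρ0
  obtain ⟨C, hC, hbound⟩ := p.norm_mul_pow_le_of_lt_radius hρ
  have hrad : 0 < P.radius := by
    let τ : NNReal := ⟨ρ / (c + 1), by positivity⟩
    have hτ : (0 : ℝ) < τ := by change 0 < (ρ : ℝ) / (c + 1); positivity
    refine lt_of_lt_of_le (by exact_mod_cast hτ) (P.le_radius_of_bound (r := τ) C fun k => ?_)
    refine le_trans ?_ (hbound k)
    have h1 : c * (τ : ℝ) ≤ ρ := by
      change c * ((ρ : ℝ) / (c + 1)) ≤ ρ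
      rw [← mul_div_assoc, div_le_iff₀ (by positivity)]
      nlinarith
    calc ‖P k‖ * (τ : ℝ) ^ k ≤ c ^ k * ‖p k‖ * (τ : ℝ) ^ k := by gcongr; exact hnorm k
      _ = ‖p k‖ * (c * τ) ^ k := by rw [mul_pow]; ring
      _ ≤ ‖p k‖ * (ρ : ℝ) ^ k := by gcongr
  refine ⟨fun x => P.sum (x - fun i => (a i : ℂ)), ?_, ?_⟩
  · have h1 : AnalyticAt ℂ P.sum 0 := (P.hasFPowerSeriesOnBall hrad).analyticAt
    refine AnalyticAt.comp_of_eq (g := P.sum) h1 (analyticAt_id.sub analyticAt_const) ?_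
    simp
  · filter_upwards [hp.eventually_hasSum_sub] with x hx
    rw [← hx.tsum_eq, Complex.ofReal_tsum, FormalMultilinearSeries.sum]
    refine tsum_congr fun k => ?_
    rw [← hPreal]
    congr 1
    ext
    simp

/-- The complexification of a real-analytic function on `ℂ^N`. -/
theorem exists_complexification {N : ℕ} {ρ : (Fin N → ℂ) → ℝ} {q : Fin N → ℂ}
    (hρ : AnalyticAt ℝ ρ q) :
    ∃ R : (Fin N → ℂ) × (Fin N → ℂ) → ℂ, AnalyticAt ℂ R (q, star q) ∧
      ∀ᶠ x in 𝓝 q, R (x, star x) = ρ x := by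
  let l : (Fin N ⊕ Fin N → ℝ) →L[ℝ] (Fin N → ℂ) := ContinuousLinearMap.pi fun j =>
    Complex.ofRealCLM ∘L ContinuousLinearMap.proj (Sum.inl j) +
      Complex.I • (Complex.ofRealCLM ∘L ContinuousLinearMap.proj (Sum.inr j))
  let b : (Fin N → ℂ) → (Fin N ⊕ Fin N → ℝ) := fun x =>
    Sum.elim (fun j => (x j).re) (fun j => (x j).im)
  have hlb : ∀ x, l (b x) = x := by
    intro x
    ext j
    simp only [l, b, ContinuousLinearMap.coe_pi']
    simp [mul_comm Complex.I]
  have hb : Continuous b := by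
    refine continuous_pi fun s => ?_
    rcases s with j | j
    · exact Complex.continuous_re.comp (continuous_apply j)
    · exact Complex.continuous_im.comp (continuous_apply j)
  obtain ⟨F, hF, hFρ⟩ := exists_holomorphic_extension (f := fun y => ρ (l y)) (a := b q)
    (AnalyticAt.comp_of_eq hρ (l.analyticAt _) (hlb q))
  -- The formulas for real and imaginary parts, with the conjugate of `z` replaced by an independent
  -- variable.
  let T : (Fin N → ℂ) × (Fin N → ℂ) → (Fin N ⊕ Fin N → ℂ) := fun p s =>
    Sum.elim (fun j => (p.1 j + p.2 j) / 2) (fun j => (p.1 j - p.2 j) / (2 * Complex.I)) s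
  have hT : ∀ p, AnalyticAt ℂ T p := by
    intro p
    have h1 : ∀ j, AnalyticAt ℂ (fun p : (Fin N → ℂ) × (Fin N → ℂ) => p.1 j) p := fun j =>
      ((ContinuousLinearMap.proj (R := ℂ) (φ := fun _ : Fin N => ℂ) j) ∘L
        ContinuousLinearMap.fst ℂ (Fin N → ℂ) (Fin N → ℂ)).analyticAt p
    have h2 : ∀ j, AnalyticAt ℂ (fun p : (Fin N → ℂ) × (Fin N → ℂ) => p.2 j) p := fun j =>
      ((ContinuousLinearMap.proj (R := ℂ) (φ := fun _ : Fin N => ℂ) j) ∘L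
        ContinuousLinearMap.snd ℂ (Fin N → ℂ) (Fin N → ℂ)).analyticAt p
    refine AnalyticAt.pi fun s => ?_
    rcases s with j | j
    · exact ((h1 j).add (h2 j)).div_const
    · exact ((h1 j).sub (h2 j)).div_const
  have hTb : ∀ x, T (x, star x) = fun s => (b x s : ℂ) := by
    intro x
    ext s
    rcases s with j | j
    · simp only [T, b, Sum.elim_inl, Pi.star_apply, Complex.star_def]
      rw [Complex.add_conj]; push_cast; ring
    · simp only [T, b, Sum.elim_inr, Pi.star_apply, Complex.star_def]
      rw [Complex.sub_conj]; field_simp; push_cast; ring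
  refine ⟨fun p => F (T p), AnalyticAt.comp_of_eq hF (hT _) (hTb q), ?_⟩
  filter_upwards [hb.continuousAt.eventually hFρ] with x hx
  rw [hTb, hx, hlb]

end Complexification

/-! ### Wirtinger derivatives as holomorphic partial derivatives on the diagonal. -/

section Wirtinger

variable {N : ℕ}

theorem wirtingerDeriv_congr {f g : (Fin N → ℂ) → ℂ} {x : Fin N → ℂ} (h : f =ᶠ[𝓝 x] g)
    (j : Fin N) : wirtingerDeriv j f x = wirtingerDeriv j g x := by
  simp only [wirtingerDeriv, h.fderiv_eq]

theorem wirtingerDerivBar_congr {f g : (Fin N → ℂ) → ℂ} {x : Fin N → ℂ} (h : f =ᶠ[𝓝 x] g)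
    (j : Fin N) : wirtingerDerivBar j f x = wirtingerDerivBar j g x := by
  simp only [wirtingerDerivBar, h.fderiv_eq]

theorem antiholApply_congr {N : ℕ} (a : (Fin N → ℂ) → (Fin N → ℂ)) {f g : (Fin N → ℂ) → ℂ}
    {x : Fin N → ℂ} (h : f =ᶠ[𝓝 x] g) : antiholApply a f x = antiholApply a g x := by
  simp only [antiholApply, wirtingerDerivBar_congr h]

theorem fderiv_diagonal {U : (Fin N → ℂ) × (Fin N → ℂ) → ℂ} {x : Fin N → ℂ}
    (hU : DifferentiableAt ℂ U (x, star x)) (h : Fin N → ℂ) :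
    fderiv ℝ (fun y => U (y, star y)) x h = fderiv ℂ U (x, star x) (h, star h) := by
  have h1 : HasFDerivAt (𝕜 := ℝ) (fun y : Fin N → ℂ => (y, star y))
      ((ContinuousLinearMap.id ℝ _).prod (starL' ℝ : (Fin N → ℂ) ≃L[ℝ] _).toContinuousLinearMap) x :=
    (hasFDerivAt_id x).prodMk (starL' ℝ : (Fin N → ℂ) ≃L[ℝ] _).hasFDerivAt
  have h2 := (hU.hasFDerivAt.restrictScalars ℝ).comp x h1
  exact DFunLike.congr_fun h2.fderiv h

theorem star_single (j : Fin N) (c : ℂ) :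
    star (Pi.single j c : Fin N → ℂ) = Pi.single j (star c) := by
  ext k
  by_cases h : k = j
  · subst h; simp
  · simp [h]

/-- The real directions `e_j` and `i e_j` lift to `(e_j, e_j)` and `i (e_j, -e_j)`. The Wirtinger
combination of these isolates the first factor, and the conjugate one the second. -/
theorem wirtingerDeriv_diagonal {U : (Fin N → ℂ) × (Fin N → ℂ) → ℂ} {x : Fin N → ℂ}
    (hU : DifferentiableAt ℂ U (x, star x)) (j : Fin N) :
    wirtingerDeriv j (fun y => U (y, star y)) x = fderiv ℂ U (x, star x) (Pi.single j 1, 0) := by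
  have h1 : ((Pi.single j Complex.I, star (Pi.single j Complex.I)) : (Fin N → ℂ) × (Fin N → ℂ)) =
      Complex.I • (Pi.single j 1, -Pi.single j 1) := by
    simp [← Pi.single_neg, ← Pi.single_smul]
  have h2 : ((Pi.single j 1, 0) : (Fin N → ℂ) × (Fin N → ℂ)) =
      (1 / 2 : ℂ) • ((Pi.single j 1, Pi.single j 1) + (Pi.single j 1, -Pi.single j 1)) := by
    simp [← two_smul ℂ, smul_smul]
  rw [wirtingerDeriv, fderiv_diagonal hU, fderiv_diagonal hU, h1, h2, star_single, map_smul,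
    map_smul, map_add, star_one, smul_eq_mul, smul_eq_mul, ← mul_assoc, Complex.I_mul_I]
  ring

theorem wirtingerDerivBar_diagonal {U : (Fin N → ℂ) × (Fin N → ℂ) → ℂ} {x : Fin N → ℂ}
    (hU : DifferentiableAt ℂ U (x, star x)) (j : Fin N) :
    wirtingerDerivBar j (fun y => U (y, star y)) x = fderiv ℂ U (x, star x) (0, Pi.single j 1) := by
  have h1 : ((Pi.single j Complex.I, star (Pi.single j Complex.I)) : (Fin N → ℂ) × (Fin N → ℂ)) =
      Complex.I • (Pi.single j 1, -Pi.single j 1) := by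
    simp [← Pi.single_neg, ← Pi.single_smul]
  have h2 : ((0, Pi.single j 1) : (Fin N → ℂ) × (Fin N → ℂ)) =
      (1 / 2 : ℂ) • ((Pi.single j 1, Pi.single j 1) - (Pi.single j 1, -Pi.single j 1)) := by
    simp [← two_smul ℂ, smul_smul]
  rw [wirtingerDerivBar, fderiv_diagonal hU, fderiv_diagonal hU, h1, h2, star_single, map_smul,
    map_smul, map_sub, star_one, smul_eq_mul, smul_eq_mul, ← mul_assoc, Complex.I_mul_I]
  ring

end Wirtinger

/-! ### Parametrized Segre varieties. -/

section Segre

variable {N n : ℕ}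

theorem fderiv_ofReal_comp {ρ : (Fin N → ℂ) → ℝ} {x : Fin N → ℂ} (hρ : DifferentiableAt ℝ ρ x)
    (h : Fin N → ℂ) : fderiv ℝ (fun y => (ρ y : ℂ)) x h = (fderiv ℝ ρ x h : ℂ) := by
  have := (Complex.ofRealCLM.hasFDerivAt (x := ρ x)).comp x hρ.hasFDerivAt
  exact DFunLike.congr_fun this.fderiv h

/-- A real covector is determined by its values on the vectors `e_j` and `i e_j`. -/
theorem clm_ext_single {F : Type*} [AddCommGroup F] [Module ℝ F] [TopologicalSpace F]
    {f g : (Fin N → ℂ) →L[ℝ] F}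
    (h1 : ∀ j, f (Pi.single j 1) = g (Pi.single j 1))
    (h2 : ∀ j, f (Pi.single j Complex.I) = g (Pi.single j Complex.I)) : f = g := by
  ext v
  have hv : v = ∑ j, ((v j).re • (Pi.single j 1 : Fin N → ℂ) +
      (v j).im • (Pi.single j Complex.I : Fin N → ℂ)) := by
    ext k
    simp only [Finset.sum_apply, Pi.add_apply, Pi.smul_apply, Pi.single_apply]
    simp [Finset.sum_add_distrib]
  rw [hv]
  simp only [map_sum, map_add, map_smul, h1, h2]

theorem exists_wirtingerDerivBar_ne_zero {ρ : (Fin N → ℂ) → ℝ} {x : Fin N → ℂ}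
    (hρ : DifferentiableAt ℝ ρ x) (h : fderiv ℝ ρ x ≠ 0) :
    ∃ j, wirtingerDerivBar j (fun y => (ρ y : ℂ)) x ≠ 0 := by
  by_contra! hcon
  have key : ∀ j, fderiv ℝ ρ x (Pi.single j 1) = 0 ∧ fderiv ℝ ρ x (Pi.single j Complex.I) = 0 := by
    intro j
    have h1 := hcon j
    rw [wirtingerDerivBar, fderiv_ofReal_comp hρ, fderiv_ofReal_comp hρ] at h1
    have h2 := (mul_eq_zero.1 h1).resolve_left (by norm_num)
    have hre := congrArg Complex.re h2
    have him := congrArg Complex.im h2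
    simp at hre him
    exact ⟨hre, him⟩
  exact h (clm_ext_single (fun j => by simpa using (key j).1) (fun j => by simpa using (key j).2))

/-- Insertion of a coordinate, as a continuous linear map. -/
noncomputable def insertNthL (m : Fin (n + 1)) : (Fin n → ℂ) × ℂ →L[ℂ] (Fin (n + 1) → ℂ) :=
  LinearMap.toContinuousLinearMap
    { toFun := fun p => m.insertNth p.2 p.1
      map_add' := fun p q => by
        ext j
        refine Fin.succAboveCases m ?_ (fun i => ?_) j <;> simp
      map_smul' := fun c p => by
        ext j
        refine Fin.succAboveCases m ?_ (fun i => ?_) j <;> simp }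

@[simp] theorem insertNthL_apply_same (m : Fin (n + 1)) (p : (Fin n → ℂ) × ℂ) :
    insertNthL m p m = p.2 := by
  simp [insertNthL]

@[simp] theorem insertNthL_apply_succAbove (m : Fin (n + 1)) (p : (Fin n → ℂ) × ℂ) (i : Fin n) :
    insertNthL m p (m.succAbove i) = p.1 i := by
  simp [insertNthL]

theorem insertNthL_zero_one (m : Fin (n + 1)) : insertNthL m (0, 1) = Pi.single m 1 := by
  ext j
  refine Fin.succAboveCases m ?_ (fun i => ?_) j <;> simp

theorem insertNthL_removeNth (m : Fin (n + 1)) (v : Fin (n + 1) → ℂ) :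
    insertNthL m (fun i => v (m.succAbove i), v m) = v := by
  ext j
  refine Fin.succAboveCases m ?_ (fun i => ?_) j <;> simp

/-- The conjugate of a point with the coordinate `m` removed. -/
def conjRemove (m : Fin (n + 1)) (x : Fin (n + 1) → ℂ) : Fin n → ℂ :=
  fun i => star (x (m.succAbove i))

theorem continuous_conjRemove (m : Fin (n + 1)) : Continuous (conjRemove m) :=
  continuous_pi fun _ => continuous_star.comp (continuous_apply _)

/-- A complexified defining function `R` of the hypersurface `M = {ρ = 0}` near `q`, together with
a parametrization `χ ↦ H (z, χ)` of the conjugated Segre varieties `{ζ | R (z, ζ) = 0}` by the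
coordinates of `ζ` other than `ζ_m`, for `z` in the ball of radius `r` around `q`. -/
structure SegreChart (M : Set (Fin (n + 1) → ℂ)) (ρ : (Fin (n + 1) → ℂ) → ℝ)
    (q : Fin (n + 1) → ℂ) where
  m : Fin (n + 1)
  Ω : Set ((Fin (n + 1) → ℂ) × (Fin (n + 1) → ℂ))
  R : (Fin (n + 1) → ℂ) × (Fin (n + 1) → ℂ) → ℂ
  H : (Fin (n + 1) → ℂ) × (Fin n → ℂ) → (Fin (n + 1) → ℂ)
  r : ℝ
  r_pos : 0 < r
  isOpen : IsOpen Ω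
  analytic_R : AnalyticOnNhd ℂ R Ω
  fderiv_ne_zero : ∀ p ∈ Ω, fderiv ℂ R p (0, Pi.single m 1) ≠ 0
  isDefiningFunction : IsDefiningFunction M (ball q r) ρ
  diagonal_mem : ∀ x ∈ ball q r, (x, star x) ∈ Ω
  R_diagonal : ∀ x ∈ ball q r, R (x, star x) = ρ x
  analytic_H : ∀ z ∈ ball q r, ∀ χ ∈ ball (conjRemove m q) r, AnalyticAt ℂ H (z, χ)
  H_mem : ∀ z ∈ ball q r, ∀ χ ∈ ball (conjRemove m q) r, (z, H (z, χ)) ∈ Ω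
  R_H : ∀ z ∈ ball q r, ∀ χ ∈ ball (conjRemove m q) r, R (z, H (z, χ)) = 0
  H_succAbove : ∀ p i, H p (m.succAbove i) = p.2 i
  H_conj : ∀ x ∈ M ∩ ball q r, H (x, conjRemove m x) = star x

theorem IsDefiningFunction.mono {M U V : Set (Fin N → ℂ)} {ρ : (Fin N → ℂ) → ℝ}
    (h : IsDefiningFunction M U ρ) (hV : IsOpen V) (hVU : V ⊆ U) : IsDefiningFunction M V ρ :=
  ⟨hV, h.smooth.mono hVU, fun x hx => h.zero_iff x (hVU hx),
    fun x hx => h.fderiv_ne_zero x ⟨hx.1, hVU hx.2⟩⟩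

theorem IsDefiningFunction.contDiffAt {M U : Set (Fin N → ℂ)} {ρ : (Fin N → ℂ) → ℝ}
    (h : IsDefiningFunction M U ρ) {x : Fin N → ℂ} (hx : x ∈ U) : ContDiffAt ℝ ∞ ρ x :=
  h.smooth.contDiffAt (h.isOpen.mem_nhds hx)

/-- As `dρ ≠ 0`, some `∂R/∂ζ_m` is nonzero, and the implicit function theorem solves `R (z, ζ) = 0`
for `ζ_m`. Its uniqueness part gives `H_conj`, because `R (x, star x) = 0` on `M`. -/
theorem exists_segreChart {M U : Set (Fin (n + 1) → ℂ)} {ρ : (Fin (n + 1) → ℂ) → ℝ}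
    {q : Fin (n + 1) → ℂ} (hq : q ∈ M) (hqU : q ∈ U) (hρ : IsDefiningFunction M U ρ)
    (hρa : AnalyticAt ℝ ρ q) : Nonempty (SegreChart M ρ q) := by
  obtain ⟨R, hR, hRρ⟩ := exists_complexification hρa
  obtain ⟨m, hm⟩ := exists_wirtingerDerivBar_ne_zero hρa.differentiableAt
    (hρ.fderiv_ne_zero q ⟨hq, hqU⟩)
  have hRe : (fun y => (ρ y : ℂ)) =ᶠ[𝓝 q] fun y => R (y, star y) := by
    filter_upwards [hRρ] with x hx using hx.symm
  rw [wirtingerDerivBar_congr hRe, wirtingerDerivBar_diagonal hR.differentiableAt] at hm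
  have hne : ∀ᶠ p in 𝓝 (q, star q), fderiv ℂ R p (0, Pi.single m 1) ≠ 0 := by
    have hc : ContinuousAt (fun p => fderiv ℂ R p (0, Pi.single m 1)) (q, star q) :=
      hR.fderiv.continuousAt.clm_apply continuousAt_const
    exact hc.eventually_ne hm
  obtain ⟨Ω, hΩ, hΩo, hΩq⟩ := _root_.eventually_nhds_iff.1 (hR.eventually_analyticAt.and hne)
  set χ₀ := conjRemove m q with hχ₀
  let B : ((Fin (n + 1) → ℂ) × (Fin n → ℂ)) × ℂ →L[ℂ] (Fin (n + 1) → ℂ) × (Fin (n + 1) → ℂ) :=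
    ((ContinuousLinearMap.fst ℂ _ _) ∘L (ContinuousLinearMap.fst ℂ _ _)).prod
      (insertNthL m ∘L ((ContinuousLinearMap.snd ℂ _ _ ∘L ContinuousLinearMap.fst ℂ _ _).prod
        (ContinuousLinearMap.snd ℂ _ _)))
  have hB : ∀ z χ w, B ((z, χ), w) = (z, insertNthL m (χ, w)) := fun z χ w => rfl
  set u : ((Fin (n + 1) → ℂ) × (Fin n → ℂ)) × ℂ := ((q, χ₀), star q m) with hu
  have hBconj : ∀ x, B ((x, conjRemove m x), star x m) = (x, star x) := by
    intro x
    rw [hB]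
    congr 1
    exact insertNthL_removeNth m (star x)
  have hBu : B u = (q, star q) := hBconj q
  have hGan : AnalyticAt ℂ (fun p => R (B p)) u := AnalyticAt.comp_of_eq hR (B.analyticAt u) hBu
  have cdf : ContDiffAt ℂ ω (fun p => R (B p)) u := hGan.contDiffAt
  have hω : (ω : WithTop ℕ∞) ≠ 0 := by simp
  have hGd : fderiv ℂ (fun p => R (B p)) u = fderiv ℂ R (q, star q) ∘L B := by
    have h1 : HasFDerivAt R (fderiv ℂ R (q, star q)) (B u) := by
      rw [hBu]; exact hR.differentiableAt.hasFDerivAt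
    exact (h1.comp u B.hasFDerivAt).fderiv
  have hinv : (fderiv ℂ (fun p => R (B p)) u ∘L .inr ℂ _ _).IsInvertible := by
    refine ⟨ContinuousLinearEquiv.unitsEquivAut ℂ (Units.mk0 _ hm), ?_⟩
    ext
    rw [hGd]
    simp [hB, insertNthL_zero_one]
  have hGu : R (B u) = 0 := by
    rw [hBu, hRρ.self_of_nhds, (hρ.zero_iff q hqU).2 hq, Complex.ofReal_zero]
  set ψ := cdf.implicitFunction hω hinv with hψ
  have hψu : ψ (q, χ₀) = star q m := cdf.implicitFunction_apply_self hω hinv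
  have hψan : ∀ᶠ p in 𝓝 (q, χ₀), AnalyticAt ℂ ψ p :=
    (cdf.contDiffAt_implicitFunction hω hinv).analyticAt.eventually_analyticAt
  have hψ0 : ∀ᶠ p in 𝓝 (q, χ₀), R (B (p, ψ p)) = R (B u) :=
    cdf.eventually_apply_implicitFunction hω hinv
  have hψeq : ∀ᶠ v in 𝓝 u, R (B v) = R (B u) ↔ ψ v.1 = v.2 :=
    cdf.eventually_apply_eq_iff_implicitFunction hω hinv
  have hψc : ContinuousAt ψ (q, χ₀) := hψan.self_of_nhds.continuousAt
  have hmem : ∀ᶠ p in 𝓝 (q, χ₀), B (p, ψ p) ∈ Ω := by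
    have hc : ContinuousAt (fun p => B (p, ψ p)) (q, χ₀) :=
      B.continuous.continuousAt.comp (continuousAt_id.prodMk hψc)
    refine hc.eventually_mem (hΩo.mem_nhds ?_)
    rw [hψu, hBu]
    exact hΩq
  have hdiag : ∀ᶠ x in 𝓝 q, (x, star x) ∈ Ω := by
    have hc : Continuous (fun x : Fin (n + 1) → ℂ => (x, star x)) := by fun_prop
    exact hc.continuousAt.eventually_mem (hΩo.mem_nhds hΩq)
  have hconj : ∀ᶠ x in 𝓝 q, R (x, star x) = 0 → ψ (x, conjRemove m x) = star x m := by
    have hc : Continuous (fun x : Fin (n + 1) → ℂ => ((x, conjRemove m x), star x m)) := by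
      have := continuous_conjRemove m
      fun_prop
    filter_upwards [hc.continuousAt.eventually hψeq] with x hx h0
    rw [hBconj, hGu] at hx
    exact hx.1 h0
  obtain ⟨r₁, hr₁, h₁⟩ := Metric.eventually_nhds_iff_ball.1
    (hdiag.and (hconj.and (hRρ.and (hρ.isOpen.mem_nhds hqU))))
  obtain ⟨r₂, hr₂, h₂⟩ := Metric.eventually_nhds_iff_ball.1 (hψan.and (hψ0.and hmem))
  have hb₁ : ∀ x ∈ ball q (min r₁ r₂), x ∈ ball q r₁ := fun x hx =>
    ball_subset_ball (min_le_left _ _) hx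
  have hb₂ : ∀ z ∈ ball q (min r₁ r₂), ∀ χ ∈ ball χ₀ (min r₁ r₂), (z, χ) ∈ ball (q, χ₀) r₂ := by
    intro z hz χ hχ
    rw [← ball_prod_same]
    exact ⟨ball_subset_ball (min_le_right _ _) hz, ball_subset_ball (min_le_right _ _) hχ⟩
  have hH : ∀ p, AnalyticAt ℂ ψ p → AnalyticAt ℂ (fun p => insertNthL m (p.2, ψ p)) p :=
    fun p hp => AnalyticAt.comp_of_eq (g := insertNthL m)
      (f := fun p : (Fin (n + 1) → ℂ) × (Fin n → ℂ) => (p.2, ψ p))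
      ((insertNthL m).analyticAt (p.2, ψ p)) (analyticAt_snd.prod hp) rfl
  exact ⟨{
    m := m
    Ω := Ω
    R := R
    H := fun p => insertNthL m (p.2, ψ p)
    r := min r₁ r₂
    r_pos := lt_min hr₁ hr₂
    isOpen := hΩo
    analytic_R := fun p hp => (hΩ p hp).1
    fderiv_ne_zero := fun p hp => (hΩ p hp).2
    isDefiningFunction := hρ.mono isOpen_ball fun x hx => (h₁ x (hb₁ x hx)).2.2.2
    diagonal_mem := fun x hx => (h₁ x (hb₁ x hx)).1
    R_diagonal := fun x hx => (h₁ x (hb₁ x hx)).2.2.1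
    analytic_H := fun z hz χ hχ => hH _ (h₂ _ (hb₂ z hz χ hχ)).1
    H_mem := fun z hz χ hχ => (h₂ _ (hb₂ z hz χ hχ)).2.2
    R_H := fun z hz χ hχ => ((h₂ _ (hb₂ z hz χ hχ)).2.1).trans hGu
    H_succAbove := fun p i => insertNthL_apply_succAbove m _ i
    H_conj := fun x hx => by
      have h := h₁ x (hb₁ x hx.2)
      have h0 : R (x, star x) = 0 := by
        rw [h.2.2.1, (hρ.zero_iff x h.2.2.2).2 hx.1, Complex.ofReal_zero]
      change insertNthL m (conjRemove m x, ψ (x, conjRemove m x)) = _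
      rw [h.2.1 h0]
      exact insertNthL_removeNth m (star x) }⟩

end Segre

/-! ### Holomorphic functions determined by their derivatives at a point. -/

section IteratedPartials

theorem analyticAt_clm_apply {E F G : Type*} [NormedAddCommGroup E] [NormedSpace ℂ E]
    [NormedAddCommGroup F] [NormedSpace ℂ F] [NormedAddCommGroup G] [NormedSpace ℂ G]
    [CompleteSpace F] [CompleteSpace G] {A : E → F →L[ℂ] G} {v : E → F} {x : E}
    (hA : AnalyticAt ℂ A x) (hv : AnalyticAt ℂ v x) : AnalyticAt ℂ (fun y => A y (v y)) x :=
  ((hA.contDiffAt (n := ω)).clm_apply hv.contDiffAt).analyticAt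

/-- A relation preserved by the operators `f i` and `g i` is preserved by their monomials. -/
theorem foldr_iterate_rel {ι A B : Type*} (rel : A → B → Prop) {f : ι → A → A} {g : ι → B → B}
    (h : ∀ i a b, rel a b → rel (f i a) (g i b)) (l : List ι) (α : ι → ℕ) {a : A} {b : B}
    (hab : rel a b) :
    rel (l.foldr (fun i a => (f i)^[α i] a) a) (l.foldr (fun i b => (g i)^[α i] b) b) := by
  induction l with
  | nil => exact hab
  | cons i l ih =>
    simp only [List.foldr_cons]
    induction α i with
    | zero => exact ih
    | succ k ihk =>
      rw [Function.iterate_succ_apply', Function.iterate_succ_apply']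
      exact h _ _ _ ihk

variable {n : ℕ}

/-- The holomorphic partial derivative in the direction of the coordinate `i`. -/
noncomputable def holPartial (i : Fin n) (h : (Fin n → ℂ) → ℂ) : (Fin n → ℂ) → ℂ :=
  fun χ => fderiv ℂ h χ (Pi.single i 1)

theorem AnalyticOnNhd.holPartial {s : Set (Fin n → ℂ)} {h : (Fin n → ℂ) → ℂ}
    (hh : AnalyticOnNhd ℂ h s) (i : Fin n) : AnalyticOnNhd ℂ (holPartial i h) s :=
  fun x hx => analyticAt_clm_apply (hh x hx).fderiv analyticAt_const

theorem eqOn_zero_of_iterate_deriv_eq_zero {f : ℂ → ℂ} {a c : ℂ} {r : ℝ}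
    (hf : AnalyticOnNhd ℂ f (ball a r)) (hc : c ∈ ball a r) (h : ∀ k, deriv^[k] f c = 0) :
    Set.EqOn f 0 (ball a r) := by
  obtain ⟨ε, hε, hball⟩ := Metric.isOpen_iff.1 isOpen_ball c hc
  refine hf.eqOn_zero_of_preconnected_of_eventuallyEq_zero (convex_ball _ _).isPreconnected hc ?_
  filter_upwards [ball_mem_nhds c hε] with z hz
  have := Complex.hasSum_taylorSeries_on_ball ((hf.mono hball).differentiableOn) hz
  simp only [iteratedDeriv_eq_iterate, h, smul_zero] at this
  exact this.unique hasSum_zero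

theorem iterate_deriv_update {χ₀ χ : Fin n → ℂ} {r : ℝ} {g : (Fin n → ℂ) → ℂ}
    (hg : AnalyticOnNhd ℂ g (ball χ₀ r)) (i : Fin n)
    (hmem : ∀ t ∈ ball (χ₀ i) r, Function.update χ i t ∈ ball χ₀ r) (k : ℕ) :
    AnalyticOnNhd ℂ ((holPartial i)^[k] g) (ball χ₀ r) ∧ ∀ t ∈ ball (χ₀ i) r,
      deriv^[k] (fun s => g (Function.update χ i s)) t =
        (holPartial i)^[k] g (Function.update χ i t) := by
  induction k with
  | zero => exact ⟨hg, fun t _ => rfl⟩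
  | succ k ih =>
    obtain ⟨han, heq⟩ := ih
    rw [Function.iterate_succ_apply', Function.iterate_succ_apply']
    refine ⟨han.holPartial i, fun t ht => ?_⟩
    have h1 : deriv^[k] (fun s => g (Function.update χ i s)) =ᶠ[𝓝 t]
        fun s => (holPartial i)^[k] g (Function.update χ i s) := by
      filter_upwards [isOpen_ball.mem_nhds ht] with s hs using heq s hs
    rw [h1.deriv_eq]
    exact ((han _ (hmem t ht)).differentiableAt.hasFDerivAt.comp_hasDerivAt t
      (hasDerivAt_update χ i t)).deriv

/-- A holomorphic function on a polydisc all of whose iterated partial derivatives (in a fixed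
order of the coordinates) vanish at a point is zero. -/
theorem eqOn_zero_of_foldr_holPartial_eq_zero {χ₀ c : Fin n → ℂ} {r : ℝ} {h : (Fin n → ℂ) → ℂ}
    (hh : AnalyticOnNhd ℂ h (ball χ₀ r)) (hc : c ∈ ball χ₀ r)
    (hzero : ∀ α : Fin n → ℕ, (List.finRange n).foldr (fun i g => (holPartial i)^[α i] g) h c = 0) :
    ∀ χ ∈ ball χ₀ r, h χ = 0 := by
  have hr : 0 < r := lt_of_le_of_lt dist_nonneg hc
  -- The coordinates are freed one at a time: only derivatives in the coordinates from `k` on are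
  -- taken, at points agreeing with `c` in those coordinates. Coordinate `k` is freed by the
  -- one-variable Taylor series along its line, which stays in the ball since sup-norm balls are
  -- polydiscs.
  have key : ∀ k ≤ n, ∀ α : Fin n → ℕ, ∀ χ ∈ ball χ₀ r, (∀ j : Fin n, k ≤ j → χ j = c j) →
      ((List.finRange n).drop k).foldr (fun i g => (holPartial i)^[α i] g) h χ = 0 := by
    intro k
    induction k with
    | zero =>
      intro _ α χ hχ hχc
      rw [funext fun j => hχc j (Nat.zero_le _)]
      exact hzero α
    | succ k ih =>
      intro hk α χ hχ hχc
      have hlen : k < (List.finRange n).length := by simpa using hk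
      have hdrop : (List.finRange n).drop k =
          (⟨k, hk⟩ : Fin n) :: (List.finRange n).drop (k + 1) := by
        rw [List.drop_eq_getElem_cons hlen]
        simp
      set i : Fin n := ⟨k, hk⟩ with hi
      set g := ((List.finRange n).drop (k + 1)).foldr (fun i g => (holPartial i)^[α i] g) h with hg
      have hnot : i ∉ (List.finRange n).drop (k + 1) := by
        have := (List.nodup_finRange n).sublist (List.drop_sublist k _)
        rw [hdrop] at this
        exact (List.nodup_cons.1 this).1
      have hgan : AnalyticOnNhd ℂ g (ball χ₀ r) :=
        foldr_iterate_rel (fun (a _ : (Fin n → ℂ) → ℂ) => AnalyticOnNhd ℂ a (ball χ₀ r))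
          (f := holPartial) (g := holPartial) (fun i _ _ ha => ha.holPartial i) _ α (b := h) hh
      have hmem : ∀ t ∈ ball (χ₀ i) r, Function.update χ i t ∈ ball χ₀ r := by
        intro t ht
        rw [mem_ball, dist_pi_lt_iff hr] at hχ ⊢
        intro j
        by_cases hj : j = i
        · subst hj; simpa using ht
        · simpa [hj] using hχ j
      have hci : ∀ j, c j ∈ ball (χ₀ j) r := (dist_pi_lt_iff hr).1 hc
      have hder : ∀ a, deriv^[a] (fun s => g (Function.update χ i s)) (c i) = 0 := by
        intro a
        rw [(iterate_deriv_update hgan i hmem a).2 _ (hci i)]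
        have h1 := ih (Nat.le_of_succ_le hk) (Function.update α i a) (Function.update χ i (c i))
          (hmem _ (hci i)) (by
            intro j hj
            by_cases hji : j = i
            · subst hji; simp
            · rw [Function.update_of_ne hji]
              refine hχc j (Nat.lt_of_le_of_ne hj fun h => hji (Fin.ext h.symm)))
        rw [hdrop, List.foldr_cons, Function.update_self] at h1
        have h2 : ((List.finRange n).drop (k + 1)).foldr
            (fun j g => (holPartial j)^[Function.update α i a j] g) h = g := by
          refine List.foldr_ext _ _ _ fun j hj b => ?_
          rw [Function.update_of_ne]
          rintro rfl
          exact hnot hj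
        rw [h2] at h1
        exact h1
      have hline : AnalyticOnNhd ℂ (fun s => g (Function.update χ i s)) (ball (χ₀ i) r) :=
        DifferentiableOn.analyticOnNhd (fun t ht =>
          ((hgan _ (hmem t ht)).differentiableAt.hasFDerivAt.comp_hasDerivAt t
            (hasDerivAt_update χ i t)).differentiableAt.differentiableWithinAt) isOpen_ball
      have := eqOn_zero_of_iterate_deriv_eq_zero hline (hci i) hder
        ((dist_pi_lt_iff hr).1 hχ i)
      simpa using this
  intro χ hχ
  have := key n le_rfl 0 χ hχ (fun j hj => absurd j.2 (not_lt.2 hj))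
  simpa using this

end IteratedPartials

/-! ### CR vector fields in Segre coordinates. -/

namespace SegreChart

variable {n : ℕ} {M : Set (Fin (n + 1) → ℂ)} {ρ : (Fin (n + 1) → ℂ) → ℝ} {q : Fin (n + 1) → ℂ}
  (S : SegreChart M ρ q)

/-- The polydisc of the parameters of the Segre varieties. -/
def D : Set (Fin n → ℂ) := ball (conjRemove S.m q) S.r

theorem conjRemove_mem {x : Fin (n + 1) → ℂ} (hx : x ∈ ball q S.r) : conjRemove S.m x ∈ S.D := by
  rw [mem_ball, dist_pi_lt_iff S.r_pos] at hx
  refine (dist_pi_lt_iff S.r_pos).2 fun i => ?_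
  have := hx (S.m.succAbove i)
  rw [conjRemove, conjRemove, dist_eq_norm, ← star_sub, norm_star, ← dist_eq_norm]
  exact this

/-- The complexified coefficients of the CR vector fields. -/
noncomputable def coeff (i : Fin n) (p : (Fin (n + 1) → ℂ) × (Fin (n + 1) → ℂ)) :
    Fin (n + 1) → ℂ :=
  Pi.single (S.m.succAbove i) 1 -
    (fderiv ℂ S.R p (0, Pi.single (S.m.succAbove i) 1) / fderiv ℂ S.R p (0, Pi.single S.m 1)) •
      Pi.single S.m 1

/-- The complexified CR vector fields. -/
noncomputable def lie (i : Fin n) (U : (Fin (n + 1) → ℂ) × (Fin (n + 1) → ℂ) → ℂ) :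
    (Fin (n + 1) → ℂ) × (Fin (n + 1) → ℂ) → ℂ :=
  fun p => fderiv ℂ U p (0, S.coeff i p)

/-- The frame of CR vector fields. -/
noncomputable def frame (i : Fin n) (x : Fin (n + 1) → ℂ) : Fin (n + 1) → ℂ := S.coeff i (x, star x)

theorem coeff_succAbove (i k : Fin n) (p) :
    S.coeff i p (S.m.succAbove k) = (Pi.single i 1 : Fin n → ℂ) k := by
  by_cases h : k = i
  · subst h; simp [coeff, Fin.succAbove_ne]
  · simp [coeff, Fin.succAbove_ne, h]

/-- Tangency fixes the remaining component `v S.m`, because `∂R/∂ζ_m` is nonzero. -/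
theorem eq_coeff {i : Fin n} {p} (hp : p ∈ S.Ω) {v : Fin (n + 1) → ℂ}
    (hv : ∀ k, v (S.m.succAbove k) = (Pi.single i 1 : Fin n → ℂ) k)
    (hR : fderiv ℂ S.R p (0, v) = 0) : v = S.coeff i p := by
  have h1 : v = Pi.single (S.m.succAbove i) 1 + v S.m • Pi.single S.m 1 := by
    ext j
    refine Fin.succAboveCases S.m ?_ (fun k => ?_) j
    · simp [(Fin.succAbove_ne S.m i).symm]
    · rw [hv]
      by_cases h : k = i
      · subst h; simp [Fin.succAbove_ne]
      · simp [Fin.succAbove_ne, h]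
  have h2 : ((0, v) : (Fin (n + 1) → ℂ) × (Fin (n + 1) → ℂ)) =
      (0, Pi.single (S.m.succAbove i) 1) + v S.m • (0, Pi.single S.m 1) := by
    rw [Prod.smul_mk, Prod.mk_add_mk, ← h1]; simp
  rw [h2, map_add, map_smul, smul_eq_mul] at hR
  have h3 : v S.m = -(fderiv ℂ S.R p (0, Pi.single (S.m.succAbove i) 1) /
      fderiv ℂ S.R p (0, Pi.single S.m 1)) := by
    have := S.fderiv_ne_zero p hp
    field_simp
    linear_combination hR
  rw [h1, h3, coeff, neg_smul, sub_eq_add_neg]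

theorem fderiv_R_coeff (i : Fin n) {p} (hp : p ∈ S.Ω) :
    fderiv ℂ S.R p (0, S.coeff i p) = 0 := by
  have h2 : ((0, S.coeff i p) : (Fin (n + 1) → ℂ) × (Fin (n + 1) → ℂ)) =
      (0, Pi.single (S.m.succAbove i) 1) - (fderiv ℂ S.R p (0, Pi.single (S.m.succAbove i) 1) /
        fderiv ℂ S.R p (0, Pi.single S.m 1)) • (0, Pi.single S.m 1) := by
    rw [Prod.smul_mk, Prod.mk_sub_mk, coeff]; simp
  rw [h2, map_sub, map_smul, smul_eq_mul, div_mul_cancel₀ _ (S.fderiv_ne_zero p hp), sub_self]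

theorem analyticAt_coeff (i : Fin n) {p} (hp : p ∈ S.Ω) : AnalyticAt ℂ (S.coeff i) p := by
  have h := (S.analytic_R p hp).fderiv
  refine analyticAt_const.fun_sub (AnalyticAt.fun_smul ?_ analyticAt_const)
  exact (analyticAt_clm_apply h analyticAt_const).fun_div (analyticAt_clm_apply h analyticAt_const)
    (S.fderiv_ne_zero p hp)

theorem analyticOnNhd_lie {U : (Fin (n + 1) → ℂ) × (Fin (n + 1) → ℂ) → ℂ}
    (hU : AnalyticOnNhd ℂ U S.Ω) (i : Fin n) : AnalyticOnNhd ℂ (S.lie i U) S.Ω :=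
  fun p hp => analyticAt_clm_apply (hU p hp).fderiv
    (analyticAt_const.prod (S.analyticAt_coeff i hp))

theorem contDiffAt_diagonal {F : Type*} [NormedAddCommGroup F] [NormedSpace ℂ F] [CompleteSpace F]
    {U : (Fin (n + 1) → ℂ) × (Fin (n + 1) → ℂ) → F} (hU : AnalyticOnNhd ℂ U S.Ω)
    {x : Fin (n + 1) → ℂ} (hx : x ∈ ball q S.r) {k : WithTop ℕ∞} :
    ContDiffAt ℝ k (fun y => U (y, star y)) x := by
  have h1 : ContDiffAt ℝ k U (x, star x) :=
    ((hU _ (S.diagonal_mem x hx)).contDiffAt).restrict_scalars ℝ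
  exact h1.comp x (f := fun y : Fin (n + 1) → ℂ => (y, star y))
    (contDiffAt_id.prodMk (starL' ℝ : (Fin (n + 1) → ℂ) ≃L[ℝ] _).contDiff.contDiffAt)

theorem antiholApply_diagonal (a : (Fin (n + 1) → ℂ) → (Fin (n + 1) → ℂ))
    {U : (Fin (n + 1) → ℂ) × (Fin (n + 1) → ℂ) → ℂ} (hU : AnalyticOnNhd ℂ U S.Ω)
    {x : Fin (n + 1) → ℂ} (hx : x ∈ ball q S.r) :
    antiholApply a (fun y => U (y, star y)) x = fderiv ℂ U (x, star x) (0, a x) := by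
  have hd := (hU _ (S.diagonal_mem x hx)).differentiableAt
  have h1 : ((0, a x) : (Fin (n + 1) → ℂ) × (Fin (n + 1) → ℂ)) =
      ∑ j, a x j • (0, Pi.single j 1) := by
    refine Prod.ext ?_ ?_
    · simp [Prod.fst_sum]
    · simp only [Prod.snd_sum, Prod.smul_snd]
      ext k
      simp [Pi.single_apply]
  rw [h1, map_sum, antiholApply]
  refine Finset.sum_congr rfl fun j _ => ?_
  rw [wirtingerDerivBar_diagonal hd, map_smul, smul_eq_mul]

/-- The vector `∂H/∂χ_i` is tangent to the Segre variety and has components `e_i` away from `m`, so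
it is `S.coeff i` by `eq_coeff`. Thus the complexified CR fields are the coordinate fields of the
parametrization. -/
theorem holPartial_comp_H {U : (Fin (n + 1) → ℂ) × (Fin (n + 1) → ℂ) → ℂ}
    (hU : AnalyticOnNhd ℂ U S.Ω) {z : Fin (n + 1) → ℂ} (hz : z ∈ ball q S.r) {χ : Fin n → ℂ}
    (hχ : χ ∈ S.D) (i : Fin n) :
    holPartial i (fun χ => U (z, S.H (z, χ))) χ = S.lie i U (z, S.H (z, χ)) := by
  have hH : HasFDerivAt (fun χ => S.H (z, χ)) (fderiv ℂ S.H (z, χ) ∘L .inr ℂ _ _) χ :=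
    (S.analytic_H z hz χ hχ).differentiableAt.hasFDerivAt.comp χ
      ((hasFDerivAt_const z χ).prodMk (hasFDerivAt_id χ))
  set T := fderiv ℂ S.H (z, χ) ∘L .inr ℂ _ _ with hT
  have hcomp : ∀ V : (Fin (n + 1) → ℂ) × (Fin (n + 1) → ℂ) → ℂ, AnalyticOnNhd ℂ V S.Ω →
      holPartial i (fun χ => V (z, S.H (z, χ))) χ =
        fderiv ℂ V (z, S.H (z, χ)) (0, T (Pi.single i 1)) := by
    intro V hV
    have h1 := (hV _ (S.H_mem z hz χ hχ)).differentiableAt.hasFDerivAt.comp χ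
      (f := fun χ => (z, S.H (z, χ))) ((hasFDerivAt_const z χ).prodMk hH)
    exact DFunLike.congr_fun h1.fderiv (Pi.single i 1)
  rw [hcomp U hU, lie]
  congr 2
  refine S.eq_coeff (S.H_mem z hz χ hχ) (fun k => ?_) ?_
  · have h1 : HasFDerivAt (fun χ => S.H (z, χ) (S.m.succAbove k))
        (ContinuousLinearMap.proj (S.m.succAbove k) ∘L T) χ :=
      (hasFDerivAt_pi'.1 hH) (S.m.succAbove k)
    simp only [S.H_succAbove] at h1
    have h2 := h1.unique (ContinuousLinearMap.proj (R := ℂ) (φ := fun _ : Fin n => ℂ) k).hasFDerivAt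
    exact DFunLike.congr_fun h2 (Pi.single i 1)
  · rw [← hcomp S.R S.analytic_R, holPartial]
    have h0 : (fun χ => S.R (z, S.H (z, χ))) =ᶠ[𝓝 χ] fun _ => 0 := by
      filter_upwards [isOpen_ball.mem_nhds hχ] with χ' hχ' using S.R_H z hz χ' hχ'
    rw [h0.fderiv_eq]
    simp

theorem isCRFrame : IsCRFrame M (ball q S.r) ρ S.frame where
  smooth i := fun x hx => ContDiffAt.contDiffWithinAt
    (S.contDiffAt_diagonal (fun p hp => S.analyticAt_coeff i hp) hx)
  tangent i x hx := by
    have h : (fun y => (ρ y : ℂ)) =ᶠ[𝓝 x] fun y => S.R (y, star y) := by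
      filter_upwards [isOpen_ball.mem_nhds hx.2] with y hy using (S.R_diagonal y hy).symm
    rw [antiholApply_congr _ h, S.antiholApply_diagonal _ S.analytic_R hx.2]
    exact S.fderiv_R_coeff i (S.diagonal_mem x hx.2)
  linearIndependent x _ := by
    refine LinearIndependent.of_comp (LinearMap.funLeft ℂ ℂ S.m.succAbove) ?_
    convert (Pi.basisFun ℂ (Fin n)).linearIndependent using 1
    ext i k
    simp only [Function.comp_apply, LinearMap.funLeft_apply, frame, S.coeff_succAbove,
      Pi.basisFun_apply]

/-- Monomials in the complexified CR vector fields. -/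
noncomputable def lieFold (α : Fin n → ℕ) (U : (Fin (n + 1) → ℂ) × (Fin (n + 1) → ℂ) → ℂ) :
    (Fin (n + 1) → ℂ) × (Fin (n + 1) → ℂ) → ℂ :=
  (List.finRange n).foldr (fun i U => (S.lie i)^[α i] U) U

theorem multiApply_frame {w : (Fin (n + 1) → ℂ) → ℂ}
    {U : (Fin (n + 1) → ℂ) × (Fin (n + 1) → ℂ) → ℂ} (hU : AnalyticOnNhd ℂ U S.Ω)
    (hw : ∀ x ∈ ball q S.r, w x = U (x, star x)) (α : Fin n → ℕ) {x : Fin (n + 1) → ℂ}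
    (hx : x ∈ ball q S.r) : multiApply S.frame α w x = S.lieFold α U (x, star x) := by
  refine (foldr_iterate_rel (fun w U => AnalyticOnNhd ℂ U S.Ω ∧
    ∀ x ∈ ball q S.r, w x = U (x, star x)) (f := fun i => antiholApply (S.frame i)) (g := S.lie)
    ?_ _ α ⟨hU, hw⟩).2 x hx
  rintro i w U ⟨hU, hw⟩
  refine ⟨S.analyticOnNhd_lie hU i, fun x hx => ?_⟩
  have h : w =ᶠ[𝓝 x] fun y => U (y, star y) := by
    filter_upwards [isOpen_ball.mem_nhds hx] with y hy using hw y hy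
  rw [antiholApply_congr _ h, S.antiholApply_diagonal _ hU hx]
  rfl

theorem foldr_holPartial_comp_H {U : (Fin (n + 1) → ℂ) × (Fin (n + 1) → ℂ) → ℂ}
    (hU : AnalyticOnNhd ℂ U S.Ω) (α : Fin n → ℕ) {z : Fin (n + 1) → ℂ} (hz : z ∈ ball q S.r)
    {χ : Fin n → ℂ} (hχ : χ ∈ S.D) :
    (List.finRange n).foldr (fun i g => (holPartial i)^[α i] g) (fun χ => U (z, S.H (z, χ))) χ =
      S.lieFold α U (z, S.H (z, χ)) := by
  refine (foldr_iterate_rel (fun h U => AnalyticOnNhd ℂ U S.Ω ∧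
    ∀ χ ∈ S.D, h χ = U (z, S.H (z, χ))) (f := holPartial) (g := S.lie)
    ?_ _ α ⟨hU, fun _ _ => rfl⟩).2 χ hχ
  rintro i h U ⟨hU, hh⟩
  refine ⟨S.analyticOnNhd_lie hU i, fun χ hχ => ?_⟩
  have h' : h =ᶠ[𝓝 χ] fun χ => U (z, S.H (z, χ)) := by
    filter_upwards [isOpen_ball.mem_nhds hχ] with χ' hχ' using hh χ' hχ'
  rw [← S.holPartial_comp_H hU hz hχ, holPartial, holPartial, h'.fderiv_eq]

end SegreChart

/-! ### Tangential derivatives of functions vanishing on the hypersurface. -/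

section Tangential

variable {N : ℕ} {M U : Set (Fin N → ℂ)} {ρ : (Fin N → ℂ) → ℝ} {x : Fin N → ℂ}

/-- Lagrange multipliers: `w` vanishes on a level set of `ρ` near `x`, so it has a local extremum
there at `x`. Its multiplier is nonzero because `dρ` is. -/
theorem IsDefiningFunction.fderiv_eq_smul (hρ : IsDefiningFunction M U ρ) (hx : x ∈ M ∩ U)
    {w : (Fin N → ℂ) → ℝ} (hw : ContDiffAt ℝ 1 w x) (h0 : ∀ᶠ y in 𝓝[M] x, w y = 0) :
    ∃ c : ℝ, fderiv ℝ w x = c • fderiv ℝ ρ x := by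
  have hρx : ρ x = 0 := (hρ.zero_iff x hx.2).2 hx.1
  have hwx : w x = 0 := h0.self_of_nhdsWithin hx.1
  have hext : IsLocalExtrOn w {y | ρ y = ρ x} x := by
    refine Or.inl ?_
    have h1 : ∀ᶠ y in 𝓝[{y | ρ y = ρ x}] x, w x ≤ w y := by
      rw [eventually_nhdsWithin_iff] at h0 ⊢
      filter_upwards [h0, hρ.isOpen.mem_nhds hx.2] with y hy hyU hyρ
      rw [hwx, hy ((hρ.zero_iff y hyU).1 (hyρ.trans hρx))]
    exact h1
  obtain ⟨a, b, hab, h⟩ := hext.exists_multipliers_of_hasStrictFDerivAt_1d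
    ((hρ.contDiffAt hx.2).hasStrictFDerivAt (by simp)) (hw.hasStrictFDerivAt one_ne_zero)
  have hb : b ≠ 0 := by
    rintro rfl
    rw [zero_smul, add_zero] at h
    rcases smul_eq_zero.1 h with ha | ha
    · exact hab (by simp [ha])
    · exact hρ.fderiv_ne_zero x hx ha
  refine ⟨-a / b, ?_⟩
  have h1 : b • fderiv ℝ w x = -(a • fderiv ℝ ρ x) := eq_neg_of_add_eq_zero_right h
  rw [← inv_smul_smul₀ hb (fderiv ℝ w x), h1]
  ext v
  simp only [smul_apply, neg_apply, smul_eq_mul]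
  ring

/-- Tangential derivatives of a function vanishing on the hypersurface vanish. -/
theorem IsDefiningFunction.exists_wirtinger_eq_mul (hρ : IsDefiningFunction M U ρ)
    (hx : x ∈ M ∩ U) {w : (Fin N → ℂ) → ℂ} (hw : ContDiffAt ℝ 1 w x)
    (h0 : ∀ᶠ y in 𝓝[M] x, w y = 0) :
    ∃ c : ℂ, (∀ j, wirtingerDeriv j w x = c * holGradient ρ j x) ∧
      ∀ a, antiholApply a w x = c * antiholApply a (fun y => (ρ y : ℂ)) x := by
  have hre : ContDiffAt ℝ 1 (fun y => (w y).re) x := Complex.reCLM.contDiff.contDiffAt.comp x hw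
  have him : ContDiffAt ℝ 1 (fun y => (w y).im) x := Complex.imCLM.contDiff.contDiffAt.comp x hw
  obtain ⟨a, ha⟩ := hρ.fderiv_eq_smul hx hre (h0.mono fun y hy => by simp [hy])
  obtain ⟨b, hb⟩ := hρ.fderiv_eq_smul hx him (h0.mono fun y hy => by simp [hy])
  have hwd : HasFDerivAt w (fderiv ℝ w x) x := (hw.differentiableAt one_ne_zero).hasFDerivAt
  have hρd : DifferentiableAt ℝ ρ x := (hρ.contDiffAt hx.2).differentiableAt (by simp)
  have key : ∀ h, fderiv ℝ w x h = (a + b * Complex.I) * fderiv ℝ (fun y => (ρ y : ℂ)) x h := by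
    intro h
    have h1 : (fderiv ℝ w x h).re = a * fderiv ℝ ρ x h := by
      have := DFunLike.congr_fun ((Complex.reCLM.hasFDerivAt.comp x hwd).fderiv.symm.trans ha) h
      simpa using this
    have h2 : (fderiv ℝ w x h).im = b * fderiv ℝ ρ x h := by
      have := DFunLike.congr_fun ((Complex.imCLM.hasFDerivAt.comp x hwd).fderiv.symm.trans hb) h
      simpa using this
    rw [fderiv_ofReal_comp hρd]
    apply Complex.ext
    · simp [h1]
    · simp [h2]
  refine ⟨a + b * Complex.I, fun j => ?_, fun v => ?_⟩
  · rw [holGradient, wirtingerDeriv, wirtingerDeriv, key, key]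
    ring
  · rw [antiholApply, antiholApply, Finset.mul_sum]
    refine Finset.sum_congr rfl fun j _ => ?_
    rw [wirtingerDerivBar, wirtingerDerivBar, key, key]
    ring

theorem star_holGradient (hρ : DifferentiableAt ℝ ρ x) (j : Fin N) :
    star (holGradient ρ j x) = wirtingerDerivBar j (fun y => (ρ y : ℂ)) x := by
  rw [holGradient, wirtingerDeriv, wirtingerDerivBar, fderiv_ofReal_comp hρ, fderiv_ofReal_comp hρ]
  simp

end Tangential

/-! ### Calculus of smooth antiholomorphic fields. -/

section Smoothness

variable {N n : ℕ} {x : Fin N → ℂ}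

theorem ContDiffAt.eventually_differentiableAt {f : (Fin N → ℂ) → ℂ} (hf : ContDiffAt ℝ ∞ f x) :
    ∀ᶠ y in 𝓝 x, DifferentiableAt ℝ f y :=
  ((hf.of_le (m := 1) (by exact_mod_cast le_top)).eventually (by simp)).mono fun _ hy =>
    hy.differentiableAt one_ne_zero

theorem ContDiffAt.wirtingerDeriv {f : (Fin N → ℂ) → ℂ} (hf : ContDiffAt ℝ ∞ f x) (j : Fin N) :
    ContDiffAt ℝ ∞ (wirtingerDeriv j f) x := by
  have h := hf.fderiv_right (m := ∞) (by simp)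
  exact contDiffAt_const.mul ((h.clm_apply contDiffAt_const).sub
    (contDiffAt_const.mul (h.clm_apply contDiffAt_const)))

theorem ContDiffAt.antiholApply {f : (Fin N → ℂ) → ℂ} {a : (Fin N → ℂ) → (Fin N → ℂ)}
    (hf : ContDiffAt ℝ ∞ f x) (ha : ContDiffAt ℝ ∞ a x) : ContDiffAt ℝ ∞ (antiholApply a f) x := by
  have h := hf.fderiv_right (m := ∞) (by simp)
  refine ContDiffAt.sum fun j _ => (contDiffAt_pi.1 ha j).mul ?_
  exact contDiffAt_const.mul ((h.clm_apply contDiffAt_const).add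
    (contDiffAt_const.mul (h.clm_apply contDiffAt_const)))

theorem contDiffAt_ofReal_comp {ρ : (Fin N → ℂ) → ℝ} (hρ : ContDiffAt ℝ ∞ ρ x) :
    ContDiffAt ℝ ∞ (fun y => (ρ y : ℂ)) x :=
  Complex.ofRealCLM.contDiff.contDiffAt.comp x hρ

theorem contDiffAt_holGradient {ρ : (Fin N → ℂ) → ℝ} (hρ : ContDiffAt ℝ ∞ ρ x) (j : Fin N) :
    ContDiffAt ℝ ∞ (holGradient ρ j) x :=
  (contDiffAt_ofReal_comp hρ).wirtingerDeriv j

theorem antiholApply_add (a : (Fin N → ℂ) → (Fin N → ℂ)) {f g : (Fin N → ℂ) → ℂ}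
    (hf : DifferentiableAt ℝ f x) (hg : DifferentiableAt ℝ g x) :
    antiholApply a (fun y => f y + g y) x = antiholApply a f x + antiholApply a g x := by
  simp only [antiholApply, wirtingerDerivBar, fderiv_fun_add hf hg, ← Finset.sum_add_distrib]
  refine Finset.sum_congr rfl fun j _ => ?_
  simp only [add_apply]
  ring

theorem antiholApply_mul (a : (Fin N → ℂ) → (Fin N → ℂ)) {f g : (Fin N → ℂ) → ℂ}
    (hf : DifferentiableAt ℝ f x) (hg : DifferentiableAt ℝ g x) :
    antiholApply a (fun y => f y * g y) x =
      antiholApply a f x * g x + f x * antiholApply a g x := by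
  simp only [antiholApply, wirtingerDerivBar, fderiv_fun_mul hf hg, Finset.mul_sum,
    Finset.sum_mul, ← Finset.sum_add_distrib]
  refine Finset.sum_congr rfl fun j _ => ?_
  simp only [add_apply, smul_apply, smul_eq_mul]
  ring

theorem antiholApply_sum (a : (Fin N → ℂ) → (Fin N → ℂ)) (v : Fin N → ℂ)
    {G : Fin N → (Fin N → ℂ) → ℂ} (hG : ∀ j, DifferentiableAt ℝ (G j) x) :
    antiholApply a (fun y => ∑ j, v j * G j y) x = ∑ j, v j * antiholApply a (G j) x := by
  have h : fderiv ℝ (fun y => ∑ j, v j * G j y) x = ∑ j, v j • fderiv ℝ (G j) x := by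
    rw [fderiv_fun_sum fun j _ => (hG j).const_mul (v j)]
    exact Finset.sum_congr rfl fun j _ => fderiv_const_mul (hG j) (v j)
  simp only [antiholApply, wirtingerDerivBar, h, sum_apply,
    smul_apply, smul_eq_mul]
  simp only [Finset.mul_sum, ← Finset.sum_add_distrib]
  rw [Finset.sum_comm]
  refine Finset.sum_congr rfl fun j _ => Finset.sum_congr rfl fun k _ => ?_
  ring

/-- Linearity of the monomials in smooth vector fields. -/
theorem multiApply_sum {L : Fin n → (Fin N → ℂ) → (Fin N → ℂ)} (hL : ∀ i, ContDiffAt ℝ ∞ (L i) x)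
    (v : Fin N → ℂ) {G : Fin N → (Fin N → ℂ) → ℂ} (hG : ∀ j, ContDiffAt ℝ ∞ (G j) x)
    (α : Fin n → ℕ) :
    multiApply L α (fun y => ∑ j, v j * G j y) x = ∑ j, v j * multiApply L α (G j) x := by
  have h1 := foldr_iterate_rel (fun (G : Fin N → (Fin N → ℂ) → ℂ) (w : (Fin N → ℂ) → ℂ) =>
    (∀ j, ContDiffAt ℝ ∞ (G j) x) ∧ w =ᶠ[𝓝 x] fun y => ∑ j, v j * G j y)
    (f := fun i G j => antiholApply (L i) (G j)) (g := fun i => antiholApply (L i)) (by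
      rintro i G w ⟨hG, hw⟩
      refine ⟨fun j => (hG j).antiholApply (hL i), ?_⟩
      have hd : ∀ᶠ y in 𝓝 x, ∀ j, DifferentiableAt ℝ (G j) y :=
        Filter.eventually_all.2 fun j => (hG j).eventually_differentiableAt
      filter_upwards [hw.eventuallyEq_nhds, hd] with y hy hyd
      rw [antiholApply_congr _ hy, antiholApply_sum _ _ hyd])
    (List.finRange n) α (a := G) ⟨hG, Filter.EventuallyEq.rfl⟩
  have h2 : ∀ j, (List.finRange n).foldr
      (fun i G => (fun G j => antiholApply (L i) (G j))^[α i] G) G j = multiApply L α (G j) :=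
    fun j => foldr_iterate_rel (fun (G : Fin N → (Fin N → ℂ) → ℂ) g => G j = g)
      (f := fun i G j => antiholApply (L i) (G j)) (g := fun i => antiholApply (L i))
      (fun i G g h => by rw [← h]) (List.finRange n) α (a := G) rfl
  have h3 := h1.2.self_of_nhds
  simp only [h2] at h3
  exact h3

end Smoothness

/-! ### Spanning sets and annihilators. -/

section Span

theorem linearMap_apply_eq_sum {N : ℕ} {F : Type*} [AddCommGroup F] [Module ℂ F]
    (f : (Fin N → ℂ) →ₗ[ℂ] F) (w : Fin N → ℂ) : f w = ∑ j, w j • f (Pi.single j 1) := by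
  conv_lhs => rw [pi_eq_sum_univ' w]
  rw [map_sum]
  exact Finset.sum_congr rfl fun j _ => map_smul _ _ _

theorem span_eq_top_of_annihilator {κ : Type*} {N : ℕ} {ψ : κ → Fin N → ℂ}
    (h : ∀ v : Fin N → ℂ, (∀ k, ∑ j, v j * ψ k j = 0) → v = 0) :
    Submodule.span ℂ (Set.range ψ) = ⊤ := by
  by_contra hne
  obtain ⟨f, hf0, hf⟩ := Submodule.exists_le_ker_of_lt_top _ (lt_top_iff_ne_top.2 hne)
  have hv := h (fun j => f (Pi.single j 1)) fun k => by
    have h1 : f (ψ k) = 0 := hf (Submodule.subset_span ⟨k, rfl⟩)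
    rw [linearMap_apply_eq_sum] at h1
    rw [← h1]
    exact Finset.sum_congr rfl fun j _ => mul_comm _ _
  refine hf0 (LinearMap.ext fun w => ?_)
  rw [linearMap_apply_eq_sum]
  simp [fun j => congrFun hv j]

end Span

/-! ### Finite nondegeneracy in terms of Segre varieties. -/

namespace SegreChart

variable {n : ℕ} {M : Set (Fin (n + 1) → ℂ)} {ρ : (Fin (n + 1) → ℂ) → ℝ} {q : Fin (n + 1) → ℂ}
  (S : SegreChart M ρ q)

/-- The class of smooth germs at `p` generated by functions whose complexification vanishes along
the conjugated Segre variety of `p`, up to functions vanishing on `M`. -/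
inductive SegreVanishing (p : Fin (n + 1) → ℂ) : ((Fin (n + 1) → ℂ) → ℂ) → Prop
  | diagonal {U : (Fin (n + 1) → ℂ) × (Fin (n + 1) → ℂ) → ℂ} (hU : AnalyticOnNhd ℂ U S.Ω)
      (h : ∀ χ ∈ S.D, U (p, S.H (p, χ)) = 0) : SegreVanishing p (fun x => U (x, star x))
  | add {w w' : (Fin (n + 1) → ℂ) → ℂ} (hw : SegreVanishing p w) (hw' : SegreVanishing p w') :
      SegreVanishing p (fun x => w x + w' x)
  | mul {c w : (Fin (n + 1) → ℂ) → ℂ} (hc : ContDiffAt ℝ ∞ c p) (hw : SegreVanishing p w) :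
      SegreVanishing p (fun x => c x * w x)
  | congr {w w' : (Fin (n + 1) → ℂ) → ℂ} (hw : ContDiffAt ℝ ∞ w p) (h : w =ᶠ[𝓝[M] p] w')
      (hw' : SegreVanishing p w') : SegreVanishing p w

variable {S} {p : Fin (n + 1) → ℂ}

theorem SegreVanishing.sum {k : ℕ} {W : Fin k → (Fin (n + 1) → ℂ) → ℂ}
    (h : ∀ i, S.SegreVanishing p (W i)) : S.SegreVanishing p (fun x => ∑ i, W i x) := by
  induction k with
  | zero =>
    have h0 := diagonal (S := S) (p := p) (U := fun _ => 0) (fun _ _ => analyticAt_const)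
      (fun _ _ => rfl)
    simpa using h0
  | succ k ih =>
    simp only [Fin.sum_univ_succ]
    exact (h 0).add (ih fun i => h i.succ)

theorem SegreVanishing.contDiffAt (hp : p ∈ ball q S.r) {w : (Fin (n + 1) → ℂ) → ℂ}
    (h : S.SegreVanishing p w) : ContDiffAt ℝ ∞ w p := by
  induction h with
  | diagonal hU _ => exact S.contDiffAt_diagonal hU hp
  | add _ _ h h' => exact h.add h'
  | mul hc _ h => exact hc.mul h
  | congr hw _ _ _ => exact hw

theorem SegreVanishing.apply_eq_zero (hp : p ∈ M ∩ ball q S.r) {w : (Fin (n + 1) → ℂ) → ℂ}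
    (h : S.SegreVanishing p w) : w p = 0 := by
  induction h with
  | diagonal hU h =>
    have := h _ (S.conjRemove_mem hp.2)
    rwa [S.H_conj p hp] at this
  | add _ _ h h' => simp only [h, h', add_zero]
  | mul _ _ h => simp only [h, mul_zero]
  | congr _ h _ h' => rw [h.self_of_nhdsWithin hp.1, h']

/-- The difference of the two sides lies in the direction `m` and is killed by `dR`, which is
nonzero on that direction. -/
theorem eq_sum_coeff {p} (hp : p ∈ S.Ω) {v : Fin (n + 1) → ℂ}
    (hv : fderiv ℂ S.R p (0, v) = 0) : v = ∑ i, v (S.m.succAbove i) • S.coeff i p := by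
  set d := v - ∑ i, v (S.m.succAbove i) • S.coeff i p with hd
  have hdk : ∀ k, d (S.m.succAbove k) = 0 := by
    intro k
    simp [hd, Finset.sum_apply, S.coeff_succAbove, Pi.single_apply]
  have hd1 : d = d S.m • Pi.single S.m 1 := by
    ext j
    refine Fin.succAboveCases S.m ?_ (fun k => ?_) j
    · simp
    · simp [hdk, Fin.succAbove_ne]
  have hdR : fderiv ℂ S.R p (0, d) = 0 := by
    have h1 : ((0, d) : (Fin (n + 1) → ℂ) × (Fin (n + 1) → ℂ)) =
        (0, v) - ∑ i, v (S.m.succAbove i) • (0, S.coeff i p) := by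
      refine Prod.ext ?_ ?_
      · simp [Prod.fst_sum]
      · simp [Prod.snd_sum, hd]
    rw [h1, map_sub, map_sum, hv, zero_sub, neg_eq_zero]
    exact Finset.sum_eq_zero fun i _ => by rw [map_smul, S.fderiv_R_coeff i hp, smul_zero]
  have h2 : ((0, d) : (Fin (n + 1) → ℂ) × (Fin (n + 1) → ℂ)) =
      d S.m • (0, Pi.single S.m 1) := by
    rw [Prod.smul_mk, smul_zero, ← hd1]
  rw [h2, map_smul, smul_eq_mul] at hdR
  have h3 := (mul_eq_zero.1 hdR).resolve_right (S.fderiv_ne_zero p hp)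
  rw [h3, zero_smul] at hd1
  exact sub_eq_zero.1 hd1

/-- The class of germs is preserved by CR vector fields. -/
theorem SegreVanishing.antiholApply (hp : p ∈ M ∩ ball q S.r) {U' : Set (Fin (n + 1) → ℂ)}
    {ρ' : (Fin (n + 1) → ℂ) → ℝ} (hpU : p ∈ U') (hρ' : IsDefiningFunction M U' ρ')
    {a : (Fin (n + 1) → ℂ) → (Fin (n + 1) → ℂ)} (ha : ContDiffAt ℝ ∞ a p)
    (htan : ∀ x ∈ M ∩ U', _root_.antiholApply a (fun y => (ρ' y : ℂ)) x = 0)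
    {w : (Fin (n + 1) → ℂ) → ℂ} (h : S.SegreVanishing p w) :
    S.SegreVanishing p (_root_.antiholApply a w) := by
  have htan' : ∀ x ∈ M ∩ U', ∀ w, ContDiffAt ℝ 1 w x → (∀ᶠ y in 𝓝[M] x, w y = 0) →
      _root_.antiholApply a w x = 0 := by
    intro x hx w hw h0
    obtain ⟨c, -, hc⟩ := hρ'.exists_wirtinger_eq_mul hx hw h0
    rw [hc, htan x hx, mul_zero]
  have hnear : ∀ᶠ x in 𝓝[M] p, x ∈ M ∧ x ∈ U' ∧ x ∈ ball q S.r := by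
    filter_upwards [self_mem_nhdsWithin, mem_nhdsWithin_of_mem_nhds (hρ'.isOpen.mem_nhds hpU),
      mem_nhdsWithin_of_mem_nhds (isOpen_ball.mem_nhds hp.2)] with x h1 h2 h3 using ⟨h1, h2, h3⟩
  induction h with
  | @diagonal U hU h0 =>
    -- Along `M` the field `a` is tangent, hence a combination of the frame with smooth
    -- coefficients. This fails off `M`, which is why the class only sees functions up to agreement
    -- on `M`. Each `S.lie i` differentiates along the Segre variety of `p`, so it preserves
    -- vanishing there.
    refine congr ((S.contDiffAt_diagonal hU hp.2).antiholApply ha)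
      (w' := fun x => ∑ i, a x (S.m.succAbove i) * S.lie i U (x, star x)) ?_
      (sum fun i => mul (contDiffAt_pi.1 ha _) (diagonal (S.analyticOnNhd_lie hU i) fun χ hχ => ?_))
    · filter_upwards [hnear] with x ⟨hxM, hxU, hxb⟩
      have hR : fderiv ℂ S.R (x, star x) (0, a x) = 0 := by
        rw [← S.antiholApply_diagonal a S.analytic_R hxb]
        refine htan' x ⟨hxM, hxU⟩ _ (S.contDiffAt_diagonal S.analytic_R hxb) ?_
        filter_upwards [self_mem_nhdsWithin,
          mem_nhdsWithin_of_mem_nhds (isOpen_ball.mem_nhds hxb)] with y hy hyb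
        rw [S.R_diagonal y hyb, (S.isDefiningFunction.zero_iff y hyb).2 hy, Complex.ofReal_zero]
      have h1 : ((0, a x) : (Fin (n + 1) → ℂ) × (Fin (n + 1) → ℂ)) =
          ∑ i, a x (S.m.succAbove i) • (0, S.coeff i (x, star x)) := by
        refine Prod.ext ?_ ?_
        · simp [Prod.fst_sum]
        · simp only [Prod.snd_sum, Prod.smul_snd]
          exact eq_sum_coeff (S.diagonal_mem x hxb) hR
      rw [S.antiholApply_diagonal a hU hxb, h1, map_sum]
      exact Finset.sum_congr rfl fun i _ => map_smul _ _ _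
    · rw [← S.holPartial_comp_H hU hp.2 hχ, holPartial]
      have hz : (fun χ => U (p, S.H (p, χ))) =ᶠ[𝓝 χ] fun _ => 0 := by
        filter_upwards [isOpen_ball.mem_nhds hχ] with χ' hχ' using h0 χ' hχ'
      rw [hz.fderiv_eq]
      simp
  | @add w w' hw hw' ih ih' =>
    refine congr (((hw.contDiffAt hp.2).add (hw'.contDiffAt hp.2)).antiholApply ha) ?_ (ih.add ih')
    refine Filter.Eventually.filter_mono nhdsWithin_le_nhds ?_
    filter_upwards [(hw.contDiffAt hp.2).eventually_differentiableAt,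
      (hw'.contDiffAt hp.2).eventually_differentiableAt] with x h h'
    exact antiholApply_add a h h'
  | @mul c w hc hw ih =>
    refine congr ((hc.mul (hw.contDiffAt hp.2)).antiholApply ha) ?_
      ((hw.mul (hc.antiholApply ha)).add (ih.mul hc))
    refine Filter.Eventually.filter_mono nhdsWithin_le_nhds ?_
    filter_upwards [hc.eventually_differentiableAt,
      (hw.contDiffAt hp.2).eventually_differentiableAt] with x h h'
    exact antiholApply_mul a h h'
  | @congr w w' hw h hw' ih =>
    refine congr (hw.antiholApply ha) ?_ ih
    -- The difference vanishes on `M` near `p`, so its tangential derivative does too.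
    have hsm : ContDiffAt ℝ ∞ (fun y => w y - w' y) p := hw.sub (hw'.contDiffAt hp.2)
    have hsm1 : ∀ᶠ x in 𝓝[M] p, ContDiffAt ℝ 1 (fun y => w y - w' y) x :=
      Filter.Eventually.filter_mono nhdsWithin_le_nhds
        ((hsm.of_le (m := 1) (by exact_mod_cast le_top)).eventually (by simp))
    have hd : ∀ᶠ x in 𝓝[M] p, DifferentiableAt ℝ w' x := Filter.Eventually.filter_mono
      nhdsWithin_le_nhds (hw'.contDiffAt hp.2).eventually_differentiableAt
    filter_upwards [hnear, hsm1, hd, eventually_eventually_nhdsWithin.2 h]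
      with x ⟨hxM, hxU, hxb⟩ hx1 hxd hxe
    have h1 := htan' x ⟨hxM, hxU⟩ _ hx1 (hxe.mono fun y hy => sub_eq_zero.2 hy)
    have h2 := antiholApply_add a (f := fun y => w y - w' y) (hx1.differentiableAt one_ne_zero) hxd
    simp only [sub_add_cancel, h1, zero_add] at h2
    exact h2

variable (S)

/-- The holomorphic gradient of the complexified defining function along Segre varieties. -/
noncomputable def phi (z : Fin (n + 1) → ℂ) (χ : Fin n → ℂ) (j : Fin (n + 1)) : ℂ :=
  fderiv ℂ S.R (z, S.H (z, χ)) (Pi.single j 1, 0)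

theorem analyticOnNhd_gradient (v : Fin (n + 1) → ℂ) :
    AnalyticOnNhd ℂ (fun p => ∑ j, v j * fderiv ℂ S.R p (Pi.single j 1, 0)) S.Ω := by
  intro p hp
  refine Finset.analyticAt_fun_sum _ fun j _ => ?_
  exact analyticAt_const.fun_mul (analyticAt_clm_apply (S.analytic_R p hp).fderiv analyticAt_const)

theorem holGradient_eq {x : Fin (n + 1) → ℂ} (hx : x ∈ ball q S.r) (j : Fin (n + 1)) :
    holGradient ρ j x = fderiv ℂ S.R (x, star x) (Pi.single j 1, 0) := by
  have h : (fun y => (ρ y : ℂ)) =ᶠ[𝓝 x] fun y => S.R (y, star y) := by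
    filter_upwards [isOpen_ball.mem_nhds hx] with y hy using (S.R_diagonal y hy).symm
  rw [holGradient, wirtingerDeriv_congr h,
    wirtingerDeriv_diagonal (S.analytic_R _ (S.diagonal_mem x hx)).differentiableAt]

theorem phi_conjRemove {x : Fin (n + 1) → ℂ} (hx : x ∈ M ∩ ball q S.r) (j : Fin (n + 1)) :
    S.phi x (conjRemove S.m x) j = holGradient ρ j x := by
  rw [S.holGradient_eq hx.2, phi, S.H_conj x hx]

theorem holGradient_m_ne_zero {x : Fin (n + 1) → ℂ} (hx : x ∈ ball q S.r) :
    holGradient ρ S.m x ≠ 0 := by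
  intro h0
  have h1 := star_holGradient ((S.isDefiningFunction.contDiffAt hx).differentiableAt (by simp)) S.m
  have h : (fun y => (ρ y : ℂ)) =ᶠ[𝓝 x] fun y => S.R (y, star y) := by
    filter_upwards [isOpen_ball.mem_nhds hx] with y hy using (S.R_diagonal y hy).symm
  rw [h0, star_zero, wirtingerDerivBar_congr h,
    wirtingerDerivBar_diagonal (S.analytic_R _ (S.diagonal_mem x hx)).differentiableAt] at h1
  exact S.fderiv_ne_zero _ (S.diagonal_mem x hx) h1.symm

variable {S}

/-- The gradients of two defining functions are proportional along `M`. The factor is the quotient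
of their components `m`, hence smooth. -/
theorem segreVanishing_gradient (hp : p ∈ M ∩ ball q S.r) {U' : Set (Fin (n + 1) → ℂ)}
    {ρ' : (Fin (n + 1) → ℂ) → ℝ} (hpU : p ∈ U') (hρ' : IsDefiningFunction M U' ρ')
    {v : Fin (n + 1) → ℂ} (hv : ∀ χ ∈ S.D, ∑ j, v j * S.phi p χ j = 0) :
    S.SegreVanishing p (fun x => ∑ j, v j * holGradient ρ' j x) := by
  have hρp := S.isDefiningFunction.contDiffAt hp.2
  have hρ'p := hρ'.contDiffAt hpU
  refine .congr (ContDiffAt.sum fun j _ => contDiffAt_const.mul (contDiffAt_holGradient hρ'p j))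
    (w' := fun x => holGradient ρ' S.m x * (holGradient ρ S.m x)⁻¹ *
      ∑ j, v j * fderiv ℂ S.R (x, star x) (Pi.single j 1, 0)) ?_
    (.mul ?_ (.diagonal (S.analyticOnNhd_gradient v) hv))
  · filter_upwards [self_mem_nhdsWithin, mem_nhdsWithin_of_mem_nhds (hρ'.isOpen.mem_nhds hpU),
      mem_nhdsWithin_of_mem_nhds (isOpen_ball.mem_nhds hp.2)] with x hxM hxU hxb
    obtain ⟨c, hc, -⟩ := S.isDefiningFunction.exists_wirtinger_eq_mul ⟨hxM, hxb⟩
      (w := fun y => (ρ' y : ℂ))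
      ((contDiffAt_ofReal_comp (hρ'.contDiffAt hxU)).of_le (by exact_mod_cast le_top)) (by
        filter_upwards [self_mem_nhdsWithin,
          mem_nhdsWithin_of_mem_nhds (hρ'.isOpen.mem_nhds hxU)] with y hy hyU
        rw [(hρ'.zero_iff y hyU).2 hy, Complex.ofReal_zero])
    have hc' : ∀ j, holGradient ρ' j x = c * holGradient ρ j x := hc
    simp only [hc', ← S.holGradient_eq hxb]
    rw [mul_inv_cancel_right₀ (S.holGradient_m_ne_zero hxb), Finset.mul_sum]
    exact Finset.sum_congr rfl fun j _ => by ring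
  · exact (contDiffAt_holGradient hρ'p _).mul
      ((contDiffAt_holGradient hρp _).inv (S.holGradient_m_ne_zero hp.2))

/-- This gives independence of the choices: membership in `SegreVanishing` survives every CR frame
and forces the value at `p` to be zero. -/
theorem sum_multiApply_eq_zero (hp : p ∈ M ∩ ball q S.r) {U' : Set (Fin (n + 1) → ℂ)}
    {ρ' : (Fin (n + 1) → ℂ) → ℝ} {L' : Fin n → (Fin (n + 1) → ℂ) → (Fin (n + 1) → ℂ)}
    (hpU : p ∈ U') (hρ' : IsDefiningFunction M U' ρ') (hL' : IsCRFrame M U' ρ' L')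
    {v : Fin (n + 1) → ℂ} (hv : ∀ χ ∈ S.D, ∑ j, v j * S.phi p χ j = 0) (α : Fin n → ℕ) :
    ∑ j, v j * multiApply L' α (holGradient ρ' j) p = 0 := by
  have hLp : ∀ i, ContDiffAt ℝ ∞ (L' i) p := fun i =>
    (hL'.smooth i).contDiffAt (hρ'.isOpen.mem_nhds hpU)
  rw [← multiApply_sum hLp v (fun j => contDiffAt_holGradient (hρ'.contDiffAt hpU) j)]
  refine SegreVanishing.apply_eq_zero hp (foldr_iterate_rel (fun w _ => S.SegreVanishing p w)
    (f := fun i => _root_.antiholApply (L' i)) (g := fun i => _root_.antiholApply (L' i))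
    (fun i w _ h => h.antiholApply hp hpU hρ' (hLp i) (hL'.tangent i)) _ α
    (b := fun _ => 0) (segreVanishing_gradient hp hpU hρ' hv))

/-- The sum is holomorphic in `χ`, and its iterated derivatives at the conjugate of `p` are the CR
derivatives in the hypothesis. -/
theorem sum_phi_eq_zero (hp : p ∈ M ∩ ball q S.r) {v : Fin (n + 1) → ℂ}
    (hv : ∀ α, ∑ j, v j * multiApply S.frame α (holGradient ρ j) p = 0) :
    ∀ χ ∈ S.D, ∑ j, v j * S.phi p χ j = 0 := by
  have hLp : ∀ i, ContDiffAt ℝ ∞ (S.frame i) p := fun i =>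
    (S.isCRFrame.smooth i).contDiffAt (isOpen_ball.mem_nhds hp.2)
  have hU := S.analyticOnNhd_gradient v
  refine eqOn_zero_of_foldr_holPartial_eq_zero
    (h := fun χ => ∑ j, v j * fderiv ℂ S.R (p, S.H (p, χ)) (Pi.single j 1, 0))
    (fun χ hχ => ?_) (S.conjRemove_mem hp.2) fun α => ?_
  · exact AnalyticAt.comp_of_eq (g := fun p => ∑ j, v j * fderiv ℂ S.R p (Pi.single j 1, 0))
      (f := fun χ => (p, S.H (p, χ))) (hU _ (S.H_mem p hp.2 χ hχ)) (analyticAt_const.prod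
      (AnalyticAt.comp_of_eq (f := fun χ => (p, χ)) (S.analytic_H p hp.2 χ hχ)
        (analyticAt_const.prod analyticAt_id) rfl)) rfl
  · rw [S.foldr_holPartial_comp_H hU α hp.2 (S.conjRemove_mem hp.2), S.H_conj p hp,
      ← S.multiApply_frame hU (w := fun x => ∑ j, v j * holGradient ρ j x) (fun x hx => ?_) α hp.2,
      multiApply_sum hLp v fun j => contDiffAt_holGradient (S.isDefiningFunction.contDiffAt hp.2) j]
    · exact hv α
    · simp only [S.holGradient_eq hx]

/-- Finite nondegeneracy in terms of Segre varieties. -/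
theorem isFinitelyNondegenerateAt_iff (hn : 1 ≤ n) (hp : p ∈ M ∩ ball q S.r) :
    IsFinitelyNondegenerateAt M p ↔
      ∀ v : Fin (n + 1) → ℂ, (∀ χ ∈ S.D, ∑ j, v j * S.phi p χ j = 0) → v = 0 := by
  constructor
  · rintro ⟨k, -, -, U', ρ', L', hpU, hρ', hL', -, htop⟩ v hv
    let f : (Fin (n + 1) → ℂ) →ₗ[ℂ] ℂ := ∑ j, v j • LinearMap.proj j
    have hf : ∀ w, f w = ∑ j, v j * w j := fun w => by simp [f]
    have hle : nondegSpace ρ' L' k p ≤ LinearMap.ker f := by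
      refine Submodule.span_le.2 ?_
      rintro _ ⟨α, -, rfl⟩
      change f _ = 0
      rw [hf]
      exact sum_multiApply_eq_zero hp hpU hρ' hL' hv α
    rw [htop] at hle
    ext j
    have h1 : f (Pi.single j 1) = 0 := hle Submodule.mem_top
    rw [hf] at h1
    simpa [Pi.single_apply] using h1
  · intro h
    have hmono : Monotone fun l => nondegSpace ρ S.frame l p := by
      intro l l' hl
      refine Submodule.span_mono ?_
      rintro _ ⟨α, hα, rfl⟩
      exact ⟨α, hα.trans hl, rfl⟩
    obtain ⟨l, hl⟩ := monotone_stabilizes_iff_noetherian.2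
      (inferInstance : IsNoetherian ℂ (Fin (n + 1) → ℂ)) ⟨_, hmono⟩
    have hall : ∀ α, (fun j => multiApply S.frame α (holGradient ρ j) p) ∈
        nondegSpace ρ S.frame l p := by
      intro α
      have h1 : nondegSpace ρ S.frame l p = nondegSpace ρ S.frame (max l (∑ i, α i)) p :=
        hl _ (le_max_left _ _)
      rw [h1]
      exact Submodule.subset_span ⟨α, le_max_right _ _, rfl⟩
    have htop : nondegSpace ρ S.frame l p = ⊤ := by
      have h1 := span_eq_top_of_annihilator
        (ψ := fun (α : Fin n → ℕ) j => multiApply S.frame α (holGradient ρ j) p)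
        fun v hv => h v (sum_phi_eq_zero hp hv)
      rw [eq_top_iff, ← h1, Submodule.span_le]
      rintro _ ⟨α, rfl⟩
      exact hall α
    classical
    have hex : ∃ l, nondegSpace ρ S.frame l p = ⊤ := ⟨l, htop⟩
    -- `E_0` is spanned by one vector, so it is proper as `n ≥ 1`. Hence the least `l` with `E_l`
    -- everything is a valid `k`.
    have hpos : Nat.find hex ≠ 0 := by
      intro h0
      have h1 := Nat.find_spec hex
      rw [h0] at h1
      have h2 : nondegSpace ρ S.frame 0 p ≤
          Submodule.span ℂ {fun j => multiApply S.frame 0 (holGradient ρ j) p} := by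
        refine Submodule.span_mono ?_
        rintro _ ⟨α, hα, rfl⟩
        have : α = 0 := by
          ext i
          exact Finset.sum_eq_zero_iff.1 (Nat.le_zero.1 hα) i (Finset.mem_univ i)
        rw [this]
        rfl
      rw [h1] at h2
      have h3 := (Submodule.finrank_mono h2).trans (finrank_span_le_card _)
      rw [finrank_top, Module.finrank_fin_fun] at h3
      simp at h3
      omega
    refine ⟨Nat.find hex, Nat.one_le_iff_ne_zero.2 hpos, hp.1, ball q S.r, ρ, S.frame, hp.2,
      S.isDefiningFunction, S.isCRFrame, ?_, Nat.find_spec hex⟩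
    rw [Nat.find_spec hex]
    exact Nat.find_min hex (Nat.sub_lt (Nat.pos_of_ne_zero hpos) one_pos)

end SegreChart

/-! ### Holomorphic annihilators of degenerate families. -/

section Annihilator

theorem analyticAt_det {E : Type*} [NormedAddCommGroup E] [NormedSpace ℂ E] {k : ℕ}
    {A : E → Matrix (Fin k) (Fin k) ℂ} {x : E} (hA : ∀ i j, AnalyticAt ℂ (fun z => A z i j) x) :
    AnalyticAt ℂ (fun z => (A z).det) x := by
  simp only [Matrix.det_apply']
  exact Finset.analyticAt_fun_sum _ fun σ _ => analyticAt_const.fun_mul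
    (Finset.analyticAt_fun_prod _ fun i _ => hA _ _)

theorem annihilator_eq_zero_iff_exists_det_ne_zero {κ : Type*} {N : ℕ} (ψ : κ → Fin N → ℂ) :
    (∀ v : Fin N → ℂ, (∀ k, ∑ j, v j * ψ k j = 0) → v = 0) ↔
      ∃ c : Fin N → κ, Matrix.det (fun a j => ψ (c a) j) ≠ 0 := by
  constructor
  · intro h
    have htop := span_eq_top_of_annihilator h
    obtain ⟨b, hb, -, hli⟩ := Submodule.exists_fun_fin_finrank_span_eq ℂ (Set.range ψ)
    generalize hm : Module.finrank ℂ (Submodule.span ℂ (Set.range ψ)) = m at b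
    rw [htop, finrank_top, Module.finrank_fin_fun] at hm
    subst hm
    choose c hc using hb
    refine ⟨c, ?_⟩
    have h1 : IsUnit (Matrix.of fun a j => ψ (c a) j) := by
      rw [← Matrix.linearIndependent_rows_iff_isUnit]
      have h2 : (Matrix.of fun a j => ψ (c a) j).row = b := funext hc
      rw [h2]
      exact hli
    exact ((Matrix.isUnit_iff_isUnit_det _).1 h1).ne_zero
  · rintro ⟨c, hc⟩ v hv
    refine Matrix.eq_zero_of_mulVec_eq_zero hc (funext fun a => ?_)
    refine Eq.trans ?_ (hv (c a))
    change ∑ j, ψ (c a) j * v j = _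
    exact Finset.sum_congr rfl fun j _ => mul_comm _ _

/-- A family of holomorphic vectors that nowhere spans `ℂ^N` is annihilated by a nontrivial
holomorphic vector. -/
theorem exists_analytic_annihilator {E : Type*} [NormedAddCommGroup E] [NormedSpace ℂ E]
    {κ : Type*} {N : ℕ} {V : Set E} (hV : IsOpen V) (hVc : IsPreconnected V) (hne : V.Nonempty)
    (φ : κ → E → Fin N → ℂ) (hφ : ∀ k j, AnalyticOnNhd ℂ (fun z => φ k z j) V)
    (hdeg : ∀ z ∈ V, Submodule.span ℂ (Set.range fun k => φ k z) ≠ ⊤) :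
    ∃ Y : E → Fin N → ℂ, (∀ j, AnalyticOnNhd ℂ (fun z => Y z j) V) ∧ (∃ z ∈ V, Y z ≠ 0) ∧
      ∀ z ∈ V, ∀ k, ∑ j, Y z j * φ k z j = 0 := by
  classical
  let rk : E → ℕ := fun z => Module.finrank ℂ (Submodule.span ℂ (Set.range fun k => φ k z))
  have hrkN : ∀ z, rk z ≤ N := fun z =>
    (Submodule.finrank_le _).trans_eq (Module.finrank_fin_fun ℂ)
  -- A point where the rank is maximal.
  obtain ⟨z₀, hz₀, hmax⟩ := WellFounded.has_min (measure fun z => N - rk z).wf V hne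
  have hmax : ∀ z ∈ V, rk z ≤ rk z₀ := by
    intro z hz
    have h1 : ¬ (N - rk z < N - rk z₀) := hmax z hz
    have h2 := hrkN z
    have h3 := hrkN z₀
    omega
  obtain ⟨b, hb, -, hli⟩ := Submodule.exists_fun_fin_finrank_span_eq ℂ (Set.range fun k => φ k z₀)
  choose s hs using hb
  obtain ⟨g, hg⟩ := exists_linearMap_det_eq_one hli
  obtain ⟨l, hl0, hl⟩ := Submodule.exists_le_ker_of_lt_top _ (lt_top_iff_ne_top.2 (hdeg z₀ hz₀))
  let A : E → Matrix (Fin (rk z₀)) (Fin (rk z₀)) ℂ := fun z => Matrix.of fun a c => g (φ (s a) z) c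
  have hAz₀ : (A z₀).det = 1 := by
    have h1 : (fun a => φ (s a) z₀) = b := funext hs
    rw [← hg, ← h1]
    rfl
  have hlin : ∀ (f : (Fin N → ℂ) →ₗ[ℂ] ℂ) k, AnalyticOnNhd ℂ (fun z => f (φ k z)) V := by
    intro f k z hz
    rw [funext fun z => linearMap_apply_eq_sum f (φ k z)]
    exact Finset.analyticAt_fun_sum _ fun j _ => (hφ k j z hz).fun_mul analyticAt_const
  have hA : ∀ a c, AnalyticOnNhd ℂ (fun z => A z a c) V := fun a c =>
    hlin ((LinearMap.proj c) ∘ₗ g) (s a)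
  -- Cramer's rule without denominators: `l` is corrected so as to kill every `φ (s a) z`. At `z₀`
  -- the correction vanishes and the determinant is `1`, so `Λ z₀ = l ≠ 0`.
  let Λ : E → (Fin N → ℂ) →ₗ[ℂ] ℂ := fun z => (A z).det • l -
    ∑ a, l (φ (s a) z) • ((LinearMap.proj a) ∘ₗ (Matrix.cramer (A z).transpose) ∘ₗ g)
  have hΛ : ∀ z w, Λ z w = (A z).det * l w -
      ∑ a, l (φ (s a) z) * Matrix.cramer (A z).transpose (g w) a := by
    intro z w
    simp [Λ]
  have hΛan : ∀ w, AnalyticOnNhd ℂ (fun z => Λ z w) V := by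
    intro w z hz
    simp only [hΛ]
    refine ((analyticAt_det fun i j => hA i j z hz).fun_mul analyticAt_const).fun_sub
      (Finset.analyticAt_fun_sum _ fun a _ => (hlin l (s a) z hz).fun_mul ?_)
    simp only [Matrix.cramer_apply]
    refine analyticAt_det fun i j => ?_
    by_cases hj : j = a
    · subst hj
      simp only [Matrix.updateCol_self]
      exact analyticAt_const
    · simp only [Matrix.updateCol_ne hj, Matrix.transpose_apply]
      exact hA j i z hz
  have hsum : ∀ z w, ∑ j, Λ z (Pi.single j 1) * w j = Λ z w := by
    intro z w
    rw [linearMap_apply_eq_sum (Λ z) w]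
    exact Finset.sum_congr rfl fun j _ => mul_comm _ _
  have hΛs : ∀ z a, Λ z (φ (s a) z) = 0 := by
    intro z a
    have h1 : Matrix.cramer (A z).transpose (g (φ (s a) z)) = Pi.single a (A z).det :=
      Matrix.cramer_transpose_row_self (A z) a
    rw [hΛ, h1]
    simp [Pi.single_apply, mul_comm]
  refine ⟨fun z j => Λ z (Pi.single j 1), fun j => hΛan _, ⟨z₀, hz₀, fun h0 => hl0 ?_⟩, ?_⟩
  · ext1 j
    ext
    have h1 : Λ z₀ (Pi.single j 1) = l (Pi.single j 1) := by
      rw [hΛ, hAz₀, one_mul, Finset.sum_eq_zero, sub_zero]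
      intro a _
      rw [show l (φ (s a) z₀) = 0 from hl (Submodule.subset_span ⟨s a, rfl⟩), zero_mul]
    simpa using h1.symm.trans (congrFun h0 j)
  · intro z hz k
    rw [hsum]
    have han : AnalyticOnNhd ℂ (fun z => Λ z (φ k z)) V := by
      intro z hz
      rw [funext fun z => (hsum z (φ k z)).symm]
      exact Finset.analyticAt_fun_sum _ fun j _ => (hΛan _ z hz).fun_mul (hφ k j z hz)
    have hdet : ∀ᶠ z in 𝓝 z₀, (A z).det ≠ 0 :=
      (analyticAt_det fun i j => hA i j z₀ hz₀).continuousAt.eventually_ne (by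
        rw [hAz₀]; exact one_ne_zero)
    -- Where the determinant is nonzero the `φ (s a) z` are independent, and by maximality of the
    -- rank they span all `φ k z`. So `Λ` kills these near `z₀`, and the identity theorem extends
    -- this to `V`.
    have hmem : ∀ᶠ z in 𝓝 z₀, (A z).det ≠ 0 ∧ z ∈ V → Λ z (φ k z) = 0 := by
      refine Filter.Eventually.of_forall fun z ⟨hz, hzV⟩ => ?_
      have hli' : LinearIndependent ℂ fun a => φ (s a) z :=
        LinearIndependent.of_comp g (Matrix.linearIndependent_rows_of_det_ne_zero hz)
      have hle : Submodule.span ℂ (Set.range fun a => φ (s a) z) ≤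
          Submodule.span ℂ (Set.range fun k => φ k z) := by
        refine Submodule.span_mono ?_
        rintro _ ⟨a, rfl⟩
        exact ⟨s a, rfl⟩
      have heq := Submodule.eq_of_le_of_finrank_le hle (by
        have h1 := finrank_span_eq_card hli'
        rw [Fintype.card_fin] at h1
        rw [h1]
        exact hmax z hzV)
      have hker : Submodule.span ℂ (Set.range fun a => φ (s a) z) ≤ LinearMap.ker (Λ z) := by
        rw [Submodule.span_le]
        rintro _ ⟨a, rfl⟩
        exact hΛs z a
      rw [heq] at hker
      exact hker (Submodule.subset_span ⟨k, rfl⟩)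
    have hzero : (fun z => Λ z (φ k z)) =ᶠ[𝓝 z₀] 0 := by
      filter_upwards [hmem, hdet, hV.mem_nhds hz₀] with z h h1 h2 using h ⟨h1, h2⟩
    exact han.eqOn_zero_of_preconnected_of_eventuallyEq_zero hVc hz₀ hzero hz

end Annihilator

/-! ### Real hypersurfaces as uniqueness sets for holomorphic functions. -/

section Uniqueness

variable {N : ℕ} {M : Set (Fin N → ℂ)} {ρ : (Fin N → ℂ) → ℝ} {q : Fin N → ℂ} {r : ℝ}

/-- Otherwise `ρ` has no zero on a punctured disc of the complex line, and since circles are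
connected it has the same sign at `s` and `-s`. The slopes at `s` and `-s` then have opposite signs,
while both tend to the nonzero derivative. -/
theorem frequently_mem_line (hρ : IsDefiningFunction M (ball q r) ρ) (hq : q ∈ M) (hr : 0 < r)
    {e : Fin N → ℂ} (he : fderiv ℝ ρ q e ≠ 0) : ∃ᶠ t : ℂ in 𝓝[≠] 0, q + t • e ∈ M := by
  have hqb : q ∈ ball q r := mem_ball_self hr
  intro hcon
  have hline : Continuous fun t : ℂ => q + t • e := by fun_prop
  have hb : ∀ᶠ t : ℂ in 𝓝[≠] 0, q + t • e ∈ ball q r :=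
    (hline.continuousAt.eventually_mem (isOpen_ball.mem_nhds (by simpa using hr))).filter_mono
      nhdsWithin_le_nhds
  have hcb := hcon.and hb
  rw [eventually_nhdsWithin_iff, Metric.eventually_nhds_iff_ball] at hcb
  obtain ⟨ε, hε, h⟩ := hcb
  have hne : ∀ t ∈ ball (0 : ℂ) ε, t ≠ 0 → ρ (q + t • e) ≠ 0 ∧ q + t • e ∈ ball q r :=
    fun t ht ht0 => ⟨fun h0 => (h t ht ht0).1 ((hρ.zero_iff _ (h t ht ht0).2).1 h0),
      (h t ht ht0).2⟩
  have hsign : ∀ s : ℝ, s ≠ 0 → |s| < ε → 0 < ρ (q + (s : ℂ) • e) * ρ (q + ((-s : ℝ) : ℂ) • e) := by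
    intro s hs0 hs
    have hsph : ∀ t ∈ sphere (0 : ℂ) |s|, t ∈ ball (0 : ℂ) ε ∧ t ≠ 0 := by
      intro t ht
      rw [mem_sphere_zero_iff_norm] at ht
      refine ⟨by rwa [mem_ball_zero_iff, ht], ?_⟩
      rintro rfl
      rw [norm_zero] at ht
      exact hs0 (abs_eq_zero.1 ht.symm)
    have hpre : IsPreconnected (sphere (0 : ℂ) |s|) :=
      isPreconnected_sphere (by rw [Complex.rank_real_complex]; norm_num) _ _
    have hcont : ContinuousOn (fun t : ℂ => ρ (q + t • e)) (sphere 0 |s|) :=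
      hρ.smooth.continuousOn.comp hline.continuousOn fun t ht =>
        (hne t (hsph t ht).1 (hsph t ht).2).2
    have hs1 : (s : ℂ) ∈ sphere (0 : ℂ) |s| := by simp
    have hs2 : ((-s : ℝ) : ℂ) ∈ sphere (0 : ℂ) |s| := by simp
    by_contra! hle
    have h0 : (0 : ℝ) ∈ (fun t : ℂ => ρ (q + t • e)) '' sphere 0 |s| := by
      rcases le_total (ρ (q + (s : ℂ) • e)) 0 with h1 | h1
      · have h2 : 0 ≤ ρ (q + ((-s : ℝ) : ℂ) • e) := by
          by_contra! h3
          rcases h1.lt_or_eq with h4 | h4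
          · exact absurd hle (not_le.2 (mul_pos_of_neg_of_neg h4 h3))
          · exact (hne _ (hsph _ hs1).1 (hsph _ hs1).2).1 h4
        exact hpre.intermediate_value hs1 hs2 hcont ⟨h1, h2⟩
      · have h2 : ρ (q + ((-s : ℝ) : ℂ) • e) ≤ 0 := by
          by_contra! h3
          rcases h1.lt_or_eq with h4 | h4
          · exact absurd hle (not_le.2 (mul_pos h4 h3))
          · exact (hne _ (hsph _ hs1).1 (hsph _ hs1).2).1 h4.symm
        exact hpre.intermediate_value hs2 hs1 hcont ⟨h2, h1⟩
    obtain ⟨t, ht, ht0⟩ := h0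
    exact (hne t (hsph t ht).1 (hsph t ht).2).1 ht0
  have hder : HasDerivAt (fun s : ℝ => ρ (q + (s : ℂ) • e)) (fderiv ℝ ρ q e) 0 := by
    have h1 : HasDerivAt (fun s : ℝ => q + (s : ℂ) • e) e 0 := by
      have h2 : HasDerivAt (fun s : ℝ => q + s • e) e 0 := by
        simpa using ((hasDerivAt_id (0 : ℝ)).smul_const e).const_add q
      exact h2
    have h3 : HasFDerivAt ρ (fderiv ℝ ρ q) (q + ((0 : ℝ) : ℂ) • e) := by
      simpa using ((hρ.contDiffAt hqb).differentiableAt (by simp)).hasFDerivAt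
    exact h3.comp_hasDerivAt (0 : ℝ) h1
  have hslope := hder.tendsto_slope
  have hρq : ρ q = 0 := (hρ.zero_iff q hqb).2 hq
  have hneg : Filter.Tendsto (fun s : ℝ => -s) (𝓝[≠] 0) (𝓝[≠] 0) := by
    refine tendsto_nhdsWithin_iff.2 ⟨?_, ?_⟩
    · exact (Continuous.tendsto' continuous_neg _ _ neg_zero).mono_left nhdsWithin_le_nhds
    · filter_upwards [self_mem_nhdsWithin] with s hs using neg_ne_zero.2 hs
  have hprod := hslope.mul (hslope.comp hneg)
  have hle : fderiv ℝ ρ q e * fderiv ℝ ρ q e ≤ 0 := by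
    refine le_of_tendsto hprod ?_
    filter_upwards [self_mem_nhdsWithin,
      mem_nhdsWithin_of_mem_nhds (ball_mem_nhds (0 : ℝ) hε)] with s hs hsε
    have h1 := hsign s hs (by simpa using hsε)
    have hs0 : s ≠ 0 := hs
    have h2 : slope (fun s : ℝ => ρ (q + (s : ℂ) • e)) 0 s *
        slope (fun s : ℝ => ρ (q + (s : ℂ) • e)) 0 (-s) =
        -(ρ (q + (s : ℂ) • e) * ρ (q + ((-s : ℝ) : ℂ) • e) / s ^ 2) := by
      simp only [slope_def_field, Complex.ofReal_zero, zero_smul, add_zero, hρq, sub_zero]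
      field_simp
    rw [Function.comp_apply, h2]
    exact neg_nonpos.2 (by positivity)
  exact absurd hle (not_le.2 (mul_self_pos.2 he))

/-- A holomorphic function vanishing on a real hypersurface vanishes identically. -/
theorem eqOn_zero_of_eventually_zero_on_hypersurface (hρ : IsDefiningFunction M (ball q r) ρ)
    (hq : q ∈ M) (hr : 0 < r) {f : (Fin N → ℂ) → ℂ} (hf : AnalyticOnNhd ℂ f (ball q r))
    (h0 : ∀ᶠ x in 𝓝[M] q, f x = 0) : ∀ x ∈ ball q r, f x = 0 := by
  have hqb : q ∈ ball q r := mem_ball_self hr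
  -- On a complex line transverse to `M` in the direction `e`, zeros of `f` accumulate at `q`, so
  -- `f` vanishes along it.
  have key : ∀ e : Fin N → ℂ, q + e ∈ ball q r → fderiv ℝ ρ q e ≠ 0 → f (q + e) = 0 := by
    intro e he hne
    have he0 : e ≠ 0 := by
      rintro rfl
      exact hne (map_zero _)
    have hpos : 0 < ‖e‖ := norm_pos_iff.2 he0
    have hline : Continuous fun t : ℂ => q + t • e := by fun_prop
    have hin : ∀ t ∈ ball (0 : ℂ) (r / ‖e‖), q + t • e ∈ ball q r := by
      intro t ht
      rw [mem_ball_zero_iff, lt_div_iff₀ hpos] at ht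
      simpa [norm_smul] using ht
    have han : AnalyticOnNhd ℂ (fun t : ℂ => f (q + t • e)) (ball 0 (r / ‖e‖)) :=
      DifferentiableOn.analyticOnNhd (fun t ht => ((hf _ (hin t ht)).differentiableAt.comp t
        (f := fun t : ℂ => q + t • e) (by fun_prop)).differentiableWithinAt) isOpen_ball
    have hmem0 : (0 : ℂ) ∈ ball (0 : ℂ) (r / ‖e‖) := mem_ball_self (by positivity)
    have hfreq : ∃ᶠ t : ℂ in 𝓝[≠] 0, f (q + t • e) = 0 := by
      have h1 : ∀ᶠ t : ℂ in 𝓝[≠] 0, q + t • e ∈ M → f (q + t • e) = 0 := by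
        refine Filter.Eventually.filter_mono nhdsWithin_le_nhds ?_
        rw [eventually_nhdsWithin_iff] at h0
        have h2 : Filter.Tendsto (fun t : ℂ => q + t • e) (𝓝 0) (𝓝 q) :=
          hline.tendsto' _ _ (by simp)
        exact h2.eventually h0
      exact (frequently_mem_line hρ hq hr hne).mp h1
    have hz := ((han 0 hmem0).frequently_zero_iff_eventually_zero).1 hfreq
    have h1 : (1 : ℂ) ∈ ball (0 : ℂ) (r / ‖e‖) := by
      rw [mem_ball_zero_iff, norm_one, one_lt_div hpos]
      simpa using he
    have := han.eqOn_zero_of_preconnected_of_eventuallyEq_zero (convex_ball _ _).isPreconnected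
      hmem0 hz h1
    simpa using this
  intro x hx
  obtain ⟨e₁, he₁⟩ : ∃ e, fderiv ℝ ρ q e ≠ 0 := by
    by_contra! hall
    exact hρ.fderiv_ne_zero q ⟨hq, hqb⟩ (ContinuousLinearMap.ext hall)
  by_cases hx0 : fderiv ℝ ρ q (x - q) = 0
  -- A direction in the kernel of `dρ` is a limit of directions outside it.
  · have hcont : Continuous fun t : ℝ => x + t • e₁ := by fun_prop
    have hlim : Filter.Tendsto (fun t : ℝ => x + t • e₁) (𝓝[≠] 0) (𝓝 x) :=
      (hcont.tendsto' _ _ (by simp)).mono_left nhdsWithin_le_nhds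
    have h1 := (hf x hx).continuousAt.tendsto.comp hlim
    have h2 : Filter.Tendsto (f ∘ fun t : ℝ => x + t • e₁) (𝓝[≠] 0) (𝓝 0) := by
      refine Filter.Tendsto.congr' ?_ tendsto_const_nhds
      filter_upwards [hlim.eventually_mem (isOpen_ball.mem_nhds hx), self_mem_nhdsWithin]
        with t ht ht0
      have h3 : q + (x - q + t • e₁) = x + t • e₁ := by abel
      refine Eq.symm ?_
      rw [Function.comp_apply, ← h3]
      refine key _ (by rwa [h3]) ?_
      rw [map_add, hx0, zero_add, map_smul]
      exact smul_ne_zero ht0 he₁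
    exact tendsto_nhds_unique h1 h2
  · have := key (x - q) (by simpa using hx) hx0
    simpa using this

end Uniqueness

/-! ### The degeneracy locus and the main theorem. -/

theorem SegreChart.analyticAt_phi {n : ℕ} {M : Set (Fin (n + 1) → ℂ)}
    {ρ : (Fin (n + 1) → ℂ) → ℝ} {q : Fin (n + 1) → ℂ} (S : SegreChart M ρ q)
    {z : Fin (n + 1) → ℂ} (hz : z ∈ ball q S.r) {χ : Fin n → ℂ} (hχ : χ ∈ S.D)
    (j : Fin (n + 1)) : AnalyticAt ℂ (fun z => S.phi z χ j) z := by
  have h1 : AnalyticAt ℂ (fun z => (z, S.H (z, χ))) z := analyticAt_id.prod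
    (AnalyticAt.comp_of_eq (f := fun z => (z, χ)) (S.analytic_H z hz χ hχ)
      (analyticAt_id.prod analyticAt_const) rfl)
  have h2 : AnalyticAt ℂ (fun z => fderiv ℂ S.R (z, S.H (z, χ))) z :=
    AnalyticAt.comp_of_eq (S.analytic_R _ (S.H_mem z hz χ hχ)).fderiv h1 rfl
  exact analyticAt_clm_apply h2 analyticAt_const

theorem mainTheorem5 (n : ℕ) (hn : 1 ≤ n) (M : Set (Fin (n + 1) → ℂ))
    (hM : IsRealAnalyticHypersurface M) (q₀ : Fin (n + 1) → ℂ) (hq₀ : q₀ ∈ M) :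
    ∃ V X : Set (Fin (n + 1) → ℂ), IsOpen V ∧ q₀ ∈ V ∧ IsComplexAnalyticVariety V X ∧
      (∀ p ∈ M ∩ V, IsFinitelyNondegenerateAt M p ↔ p ∉ X) ∧
      (IsHolomorphicallyNondegenerateAt M q₀ → interior X = ∅) := by
  obtain ⟨U, ρ, hqU, hρ, hρa⟩ := hM q₀ hq₀
  obtain ⟨S⟩ := exists_segreChart hq₀ hqU hρ (hρa q₀ hqU)
  let F : (Fin (n + 1) → S.D) → (Fin (n + 1) → ℂ) → ℂ := fun c z =>
    Matrix.det fun a j => S.phi z (c a) j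
  have hF : ∀ c, AnalyticOnNhd ℂ (F c) (ball q₀ S.r) := fun c z hz =>
    analyticAt_det fun a j => S.analyticAt_phi hz (c a).2 j
  obtain ⟨J, V₀, hV₀, hqV₀, hV₀S, hJ⟩ := hasFiniteZeroSubfamily_of_contDiffOn _
    (Fin (n + 1) → ℂ) rfl _ F (ball q₀ S.r) q₀ isOpen_ball (mem_ball_self S.r_pos)
    fun c z hz => (hF c z hz).contDiffAt.contDiffWithinAt
  -- Shrinking to a ball gives a connected `V`, needed for the identity theorem.
  obtain ⟨ε, hε, hball⟩ := Metric.isOpen_iff.1 hV₀ q₀ hqV₀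
  have hVS : ball q₀ ε ⊆ ball q₀ S.r := hball.trans hV₀S
  have hdeg : ∀ z, (∀ c, F c z = 0) ↔
      ¬ ∀ v : Fin (n + 1) → ℂ, (∀ χ ∈ S.D, ∑ j, v j * S.phi z χ j = 0) → v = 0 := by
    intro z
    have h := annihilator_eq_zero_iff_exists_det_ne_zero fun χ : S.D => S.phi z χ
    simp only [Subtype.forall] at h
    rw [h]
    push Not
    rfl
  refine ⟨ball q₀ ε, {z | z ∈ ball q₀ ε ∧ ∀ c, F c z = 0}, isOpen_ball, mem_ball_self hε,
    ⟨fun z hz => hz.1, fun p hp => ⟨ball q₀ ε, isOpen_ball, hp, subset_rfl, J.card,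
      fun i => F (J.equivFin.symm i), fun i =>
        ((hF _).mono hVS).differentiableOn, fun z hz => ⟨fun h i => h.2 _, fun h => ⟨hz, ?_⟩⟩⟩⟩,
    fun p hp => ?_, fun hnd => ?_⟩
  · refine hJ z (hball hz) fun c hc => ?_
    simpa using h (J.equivFin ⟨c, hc⟩)
  · rw [SegreChart.isFinitelyNondegenerateAt_iff (S := S) hn ⟨hp.1, hVS hp.2⟩]
    have h := hdeg p
    constructor
    · exact fun h1 h2 => h.1 h2.2 h1
    · intro h1
      by_contra h2
      exact h1 ⟨hp.2, h.2 h2⟩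
  · by_contra hne
    obtain ⟨x, hx⟩ := Set.nonempty_iff_ne_empty.2 hne
    have hpre : IsPreconnected (ball q₀ ε) := (convex_ball _ _).isPreconnected
    have hzero : ∀ c, ∀ z ∈ ball q₀ ε, F c z = 0 := by
      intro c
      refine ((hF c).mono hVS).eqOn_zero_of_preconnected_of_eventuallyEq_zero hpre
        (interior_subset hx).1 ?_
      filter_upwards [mem_interior_iff_mem_nhds.1 hx] with z hz using hz.2 c
    obtain ⟨Y, hY, ⟨z₀, hz₀, hYz₀⟩, hYphi⟩ := exists_analytic_annihilator isOpen_ball hpre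
      ⟨q₀, mem_ball_self hε⟩ (fun (χ : S.D) z => S.phi z χ)
      (fun χ j z hz => S.analyticAt_phi (hVS hz) χ.2 j) fun z hz htop => by
        refine (hdeg z).1 (fun c => hzero c z hz) fun v hv => ?_
        let f : (Fin (n + 1) → ℂ) →ₗ[ℂ] ℂ := ∑ j, v j • LinearMap.proj j
        have hf : ∀ w, f w = ∑ j, v j * w j := fun w => by simp [f]
        have hle : Submodule.span ℂ (Set.range fun χ : S.D => S.phi z χ) ≤ LinearMap.ker f := by
          rw [Submodule.span_le]
          rintro _ ⟨χ, rfl⟩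
          exact (hf _).trans (hv χ χ.2)
        rw [htop] at hle
        ext j
        have h1 : f (Pi.single j 1) = 0 := hle Submodule.mem_top
        rw [hf] at h1
        simpa [Pi.single_apply] using h1
    have hρε : IsDefiningFunction M (ball q₀ ε) ρ := S.isDefiningFunction.mono isOpen_ball hVS
    -- At `x` in `M`, the parameter conjugate to `x` turns `phi` into the gradient of `ρ`, so `Y` is
    -- tangent to `M`.
    have hYM := hnd (ball q₀ ε) ρ Y (mem_ball_self hε) hρε
      (differentiableOn_pi.2 fun j => (hY j).differentiableOn) fun x hx => by
        have hx' : x ∈ M ∩ ball q₀ S.r := ⟨hx.1, hVS hx.2⟩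
        have := hYphi x hx.2 ⟨conjRemove S.m x, S.conjRemove_mem hx'.2⟩
        simpa only [S.phi_conjRemove hx'] using this
    refine hYz₀ (funext fun j => ?_)
    exact eqOn_zero_of_eventually_zero_on_hypersurface hρε hq₀ hε (hY j)
      (hYM.mono fun x hx => congrFun hx j) z₀ hz₀
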